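/- **Theorem (Consistency of SDP-1).** *Setting.* Let $K,m\ge 1$ and $n=mK$. Let $\Psi\in[0,1]^{K\times K}$ be symmetric, write $p_k=\Psi_{kk}$, $q^*_k=\max_{\ell\ne k}\Psi_{k\ell}$ ($:=0$ if $K=1$), $q^*_{\max}=\max_k q^*_k$, and for a number $x$ put $\widetilde x = xm/\log n$ (so $\widetilde p_k=p_km/\log n$, etc.). $\Psi$ is *weakly assortative* if $p_k>q^*_k$ for all $k$. The $n$ nodes are split into $K$ communities of size $m$; a random symmetric matrix $A$ is drawn from the balanced block model $\mathrm{BM}^{\mathrm{bal}}_m(\Psi)$ if the entries $A_{ij}$, $i<j$, are independent and $A_{ij}\sim\mathrm{Bernoulli}(\Psi_{k\ell})$ for $i\ne j$ with $i$ in community $k$ and $j$ in community $\ell$ (the diagonal of $A$ is arbitrary). With the nodes ordered by community, the true cluster matrix is $X_0=I_K\otimes E_m$, where $E_m$ is the $m\times m$ all-ones matrix. SDP-1 with input $A$ is $$\max_X\ \operatorname{tr}(AX)\quad\text{subject to}\quad X\mathbf 1_n=\tfrac nK\mathbf 1_n,\quad \operatorname{diag}(X)=\mathbf 1_n,\quad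 X\succeq 0,\quad X\ge 0\ \text{entrywise},$$ over symmetric $n\times n$ real matrices $X$. *Claim.* There are universal positive constants $C,C',c,r$ such that the following two statements hold. (i) For every $n\ge1$, every random symmetric $\{0,1\}$-valued $n\times n$ matrix $A$ with zero diagonal and independent entries below the diagonal, and every $\sigma\ge 0$ with $\max_{ij}\operatorname{Var}(A_{ij})\le\sigma^2$ and $n\sigma^2\ge C'\log n$, one has $\|A-\mathbb E A\|\le C\sigma\sqrt n$ (operator norm $\ell_2\to\ell_2$) with probability at least $1-c\,n^{-r}$. (ii) For all $c_1,c_2>0$, put $C_1:=\max\{C',\tfrac49(c_1+1)\}$ and $C_2:=\max\{\sqrt{4(c_1+1)}+C,\ 6\sqrt{2(c_2+1)}\}$. Let $A$ be drawn from $\mathrm{BM}^{\mathrm{bal}}_m(\Psi)$ with $\Psi$ weakly assortative, and assume $\min_k\widetilde p_k\ge C_1$. If $$\min_k\Big[(\widetilde p_k-\widetilde{q^*_k})-C_2\big(\sqrt{\widetilde p_k}+\sqrt{\widetilde{q^*_k}}\,\big)\Big]>C\sqrt{\frac{\widetilde{q^*_{\max}}\,K}{\log n}},$$ then, with probability at least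 $$1-c\,(Km^{-r}+n^{-r})-n^{-c_1}-2m^{-1}n^{-c_2},$$ $X_0$ is the unique solution of SDP-1 with input $A$. -/

import Mathlib

open MeasureTheory ProbabilityTheory
open scoped Matrix Kronecker

universe u

noncomputable section

namespace SDPBlockModel

/-! ### Semidefinite program SDP-1 -/

/-- Feasible set of SDP-1 on the node set `V` (so `n = |V|`) with `K` communities:
`X 1 = (n/K) 1`, `diag X = 1`, `X` positive semidefinite (in particular symmetric), `X ≥ 0`
entrywise. -/
def sdp1Feasible (V : Type*) [Fintype V] (K : ℕ) : Set (Matrix V V ℝ) :=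
  {X | X *ᵥ (fun _ => 1) = (fun _ => (Fintype.card V : ℝ) / K) ∧
       X.diag = (fun _ => 1) ∧ X.PosSemidef ∧ ∀ i j, 0 ≤ X i j}

/-- Solution set of SDP-1 for the input `A`: the maximizers of `⟨A, X⟩ = tr (A X)` over the
feasible set. -/
def sdp1 {V : Type*} [Fintype V] (K : ℕ) (A : Matrix V V ℝ) : Set (Matrix V V ℝ) :=
  {X | X ∈ sdp1Feasible V K ∧ ∀ Y ∈ sdp1Feasible V K, (A * Y).trace ≤ (A * X).trace}

/-! ### Balanced block model

The `n = m K` nodes are the pairs `(k, a)` with `k : Fin K` the community and `a : Fin m` the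
position inside the community. -/

/-- The true cluster matrix `X₀ = I_K ⊗ E_m`. -/
def clusterMatrix (K m : ℕ) : Matrix (Fin K × Fin m) (Fin K × Fin m) ℝ :=
  (1 : Matrix (Fin K) (Fin K) ℝ) ⊗ₖ (Matrix.of fun _ _ => 1 : Matrix (Fin m) (Fin m) ℝ)

/-- `Ψ` is a symmetric matrix with entries in `[0,1]`. -/
structure IsEdgeProbMatrix {K : ℕ} (Ψ : Matrix (Fin K) (Fin K) ℝ) : Prop where
  symm : Ψ.IsSymm
  mem_Icc : ∀ k l, Ψ k l ∈ Set.Icc (0 : ℝ) 1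

/-- The random matrix `A` on the probability space `(Ω, μ)` is drawn from the balanced block model
with `K` communities of size `m` and edge probability matrix `Ψ`: it is symmetric, its entries
above the diagonal are independent, and the entry at two distinct nodes `i`, `j` is Bernoulli with
parameter `Ψ (community of i) (community of j)`. The diagonal entries are not part of the data and
are left arbitrary, which covers every convention for them. -/
structure IsBalancedBlockModel {Ω : Type*} [MeasurableSpace Ω] (μ : Measure Ω) {K : ℕ} (m : ℕ)
    (Ψ : Matrix (Fin K) (Fin K) ℝ) (A : Ω → Matrix (Fin K × Fin m) (Fin K × Fin m) ℝ) :
    Prop where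
  symm : ∀ ω, (A ω).IsSymm
  measurable : ∀ i j, i ≠ j → Measurable fun ω => A ω i j
  binary : ∀ ω i j, i ≠ j → A ω i j = 0 ∨ A ω i j = 1
  prob : ∀ i j, i ≠ j → μ {ω | A ω i j = 1} = ENNReal.ofReal (Ψ i.1 j.1)
  indep : iIndepFun
    (fun (e : {e : (Fin K × Fin m) × (Fin K × Fin m) // toLex e.1 < toLex e.2}) (ω : Ω) =>
      A ω e.1.1 e.1.2) μ

/-- `q*_k = max_{l ≠ k} Ψ_{kl}` (a maximum over a finite set; `0` if `k` is the only community). -/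
def qStar {K : ℕ} (Ψ : Matrix (Fin K) (Fin K) ℝ) (k : Fin K) : ℝ :=
  ⨆ l : {l : Fin K // l ≠ k}, Ψ k l

/-- `q*_max = max_k q*_k`. -/
def qStarMax {K : ℕ} (Ψ : Matrix (Fin K) (Fin K) ℝ) : ℝ := ⨆ k, qStar Ψ k

/-- Weak assortativity: `p_k > q*_k` for all `k`, where `p_k = Ψ_{kk}`. -/
def WeaklyAssortative {K : ℕ} (Ψ : Matrix (Fin K) (Fin K) ℝ) : Prop :=
  ∀ k, qStar Ψ k < Ψ k k

/-- The rescaling `x ↦ x̃ = x m / log n` with `n = m K`. -/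
def tilde (K m : ℕ) (x : ℝ) : ℝ := x * m / Real.log ((m * K : ℕ) : ℝ)

/-! ### The adjacency concentration property that the constants `(C, C', c, r)` refer to -/

/-- `(C, C', c, r)` are constants in the adjacency concentration inequality: if `A` is a random
symmetric binary `n × n` matrix with independent entries below the diagonal and zero diagonal, and
`max_{ij} Var A_{ij} ≤ σ²` with `n σ² ≥ C' log n`, then `‖A - E A‖ ≤ C σ √n` (`ℓ₂ → ℓ₂` operator
norm) with probability at least `1 - c n^{-r}`. -/
def AdjacencyConcentration (C C' c r : ℝ) : Prop :=
  ∀ (n : ℕ) (_ : 0 < n) (Ω : Type u) [MeasurableSpace Ω] (μ : Measure Ω) [IsProbabilityMeasure μ]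
    (A : Ω → Matrix (Fin n) (Fin n) ℝ) (σ : ℝ),
    (∀ i j, Measurable fun ω => A ω i j) →
    (∀ ω, (A ω).IsSymm) →
    (∀ ω i j, A ω i j = 0 ∨ A ω i j = 1) →
    (∀ ω i, A ω i i = 0) →
    iIndepFun (fun (e : {e : Fin n × Fin n // e.2 < e.1}) (ω : Ω) => A ω e.1.1 e.1.2) μ →
    0 ≤ σ →
    (∀ i j, variance (fun ω => A ω i j) μ ≤ σ ^ 2) →
    C' * Real.log n ≤ n * σ ^ 2 →
    1 - c * (n : ℝ) ^ (-r) ≤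
      μ.real {ω | ‖Matrix.toEuclideanCLM (𝕜 := ℝ)
        (A ω - Matrix.of fun i j => ∫ ω', A ω' i j ∂μ)‖ ≤ C * σ * √(n : ℝ)}

end SDPBlockModel

end

/-! Norm concentration is proved by the moment method. For a symmetric centered noise matrix `W`
with entries bounded by one and variances at most `τ`, expand `E tr W^(2p)` over closed walks.
Independence kills every walk that uses some edge exactly once, and any other walk contributes at
most `τ` per distinct edge. Such a good walk on `v + 1` vertices has at least `v` edges, so for `nτ
≤ p` the weighted sum over `n` vertices is at most `n / (2p)` times the number of good walks on `2p`
vertices (`sum_goodWalk_pow_le`).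

That number is bounded without enumerating walks. A random matrix with entries uniform on `2, -1,
-1` has entry moments equal to `0` in order one and at least `1` in every other order, so its
expected trace moment dominates the count (`card_goodWalk_le_sum_trace`). This matrix is dense of
size `2p`, and a net argument with sub-Gaussian tails shows that its norm is of order `√p`
(`card_goodWalk_le`). Markov's inequality with `p` comparable to `nτ ≥ log n` then gives `‖W‖ =
O(√(nτ))` with no logarithmic loss.

Recovery is a deterministic statement plus tail bounds. For feasible `X` put `D = X₀ - X`. It is
nonnegative inside communities and nonpositive outside, and in row `i` both parts have the same mass
`rowLoss X i`. Hence the mean matrix gains at least `(p_k - q*_k) * rowLoss` per row. For the noise,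
let `P` be the projection onto the community indicators and write `D = PD + DP - PDP - (1 - P) X (1
- P)`. The first three terms see only averages of `W` over communities, hence block row sums. The
last compression is positive semidefinite with trace `rowLoss / m` summed over rows, so it costs
operator norms: one for each diagonal block and one for the off-diagonal part. Every cost is linear
in `rowLoss`, so a strict gap in each community forces `rowLoss = 0`, that is `X = X₀`
(`sdp1_eq_singleton`). Row sums are controlled by a Chernoff bound, norms by the moment method. -/

noncomputable section

namespace SDPBlockModel

/-! ### Closed walks in which no edge is used exactly once -/

section Walks

variable {V U : Type*} [DecidableEq V] [DecidableEq U] {N : ℕ}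

/-- The edge used by the walk `u` at time `t`. -/
def walkStep (u : Fin (N + 1) → V) (t : Fin N) : Sym2 V := s(u t.castSucc, u t.succ)

/-- The number of times the walk `u` uses the edge `e`. -/
def edgeMult (u : Fin (N + 1) → V) (e : Sym2 V) : ℕ :=
  (Finset.univ.filter fun t => walkStep u t = e).card

/-- The set of edges used by the walk `u`. -/
def walkEdges (u : Fin (N + 1) → V) : Finset (Sym2 V) := Finset.univ.image (walkStep u)

/-- A closed walk in which no edge is used exactly once. -/
def IsGoodWalk (u : Fin (N + 1) → V) : Prop := u 0 = u (Fin.last N) ∧ ∀ e, edgeMult u e ≠ 1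

instance decidablePredIsGoodWalk : DecidablePred (IsGoodWalk (V := V) (N := N)) :=
  Classical.decPred _

/-- Induction on the length: a step to a vertex not visited before runs along an edge not used
before. -/
theorem card_image_le_card_walkEdges_add_one :
    ∀ {N : ℕ} (u : Fin (N + 1) → V), (Finset.univ.image u).card ≤ (walkEdges u).card + 1
  | 0, u => by
    refine Finset.card_image_le.trans ?_
    simp
  | N + 1, u => by
    have ih := card_image_le_card_walkEdges_add_one (fun i : Fin (N + 1) => u i.castSucc)
    have hV : Finset.univ.image u =
        insert (u (Fin.last _)) (Finset.univ.image fun i : Fin (N + 1) => u i.castSucc) := by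
      ext x
      simp only [Finset.mem_image, Finset.mem_univ, true_and, Finset.mem_insert]
      constructor
      · rintro ⟨i, rfl⟩
        induction i using Fin.lastCases with
        | last => exact Or.inl rfl
        | cast i => exact Or.inr ⟨i, rfl⟩
      · rintro (rfl | ⟨i, rfl⟩)
        · exact ⟨_, rfl⟩
        · exact ⟨_, rfl⟩
    have hE : walkEdges u = insert s(u (Fin.last N).castSucc, u (Fin.last _))
        (walkEdges fun i : Fin (N + 1) => u i.castSucc) := by
      ext x
      simp only [walkEdges, Finset.mem_image, Finset.mem_univ, true_and, Finset.mem_insert]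
      constructor
      · rintro ⟨i, rfl⟩
        induction i using Fin.lastCases with
        | last => exact Or.inl rfl
        | cast i => exact Or.inr ⟨i, rfl⟩
      · rintro (rfl | ⟨i, rfl⟩)
        · exact ⟨Fin.last _, rfl⟩
        · exact ⟨i.castSucc, rfl⟩
    by_cases h : u (Fin.last _) ∈ Finset.univ.image fun i : Fin (N + 1) => u i.castSucc
    · rw [hV, hE, Finset.insert_eq_of_mem h]
      refine ih.trans (Nat.add_le_add_right (Finset.card_le_card (Finset.subset_insert _ _)) 1)
    · have h' : s(u (Fin.last N).castSucc, u (Fin.last _)) ∉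
          walkEdges fun i : Fin (N + 1) => u i.castSucc := by
        intro hmem
        simp only [walkEdges, Finset.mem_image, Finset.mem_univ, true_and] at hmem
        obtain ⟨t, ht⟩ := hmem
        have : u (Fin.last _) ∈ walkStep (fun i : Fin (N + 1) => u i.castSucc) t := by
          rw [ht]; exact Sym2.mem_mk_right _ _
        rw [walkStep, Sym2.mem_iff] at this
        apply h
        rcases this with h1 | h1 <;> rw [h1] <;> exact Finset.mem_image_of_mem _ (Finset.mem_univ _)
      rw [hV, hE, Finset.card_insert_of_notMem h, Finset.card_insert_of_notMem h']
      omega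

theorem IsGoodWalk.two_mul_card_walkEdges_le {u : Fin (N + 1) → V} (hu : IsGoodWalk u) :
    2 * (walkEdges u).card ≤ N := by
  have h := Finset.card_eq_sum_card_image (walkStep u) Finset.univ
  rw [Finset.card_univ, Fintype.card_fin] at h
  refine le_of_le_of_eq ?_ h.symm
  rw [mul_comm, ← smul_eq_mul]
  refine Finset.card_nsmul_le_sum _ _ _ fun e he => ?_
  have h1 := hu.2 e
  have h0 : 0 < edgeMult u e := by
    obtain ⟨t, -, ht⟩ := Finset.mem_image.1 he
    exact Finset.card_pos.2 ⟨t, by simpa using ht⟩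
  change 2 ≤ edgeMult u e
  omega

theorem isGoodWalk_comp {φ : V → U} (hφ : Function.Injective φ) (u : Fin (N + 1) → V) :
    IsGoodWalk (φ ∘ u) ↔ IsGoodWalk u := by
  have hstep : ∀ t, walkStep (φ ∘ u) t = Sym2.map φ (walkStep u t) := fun t => rfl
  have hm : ∀ e, edgeMult (φ ∘ u) (Sym2.map φ e) = edgeMult u e := fun e => by
    simp only [edgeMult, hstep, (Sym2.map.injective hφ).eq_iff]
  refine and_congr hφ.eq_iff ⟨fun h e => hm e ▸ h _, fun h e => ?_⟩
  by_cases he : ∃ t, walkStep (φ ∘ u) t = e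
  · obtain ⟨t, rfl⟩ := he
    rw [hstep, hm]
    exact h _
  · have : edgeMult (φ ∘ u) e = 0 := by
      push Not at he
      simp [edgeMult, he]
    omega

/-- The number of good walks visiting all of `Fin v`. -/
def surjGoodCount (N v : ℕ) : ℕ :=
  (Finset.univ.filter fun u : Fin (N + 1) → Fin v =>
    IsGoodWalk u ∧ Function.Surjective u).card

/-- Goodness is invariant under injective relabelling, so the count depends on the visited set only
through its size. This makes vertex sets of different sizes `n` and `2p` comparable. -/
theorem card_goodWalk_image_eq [Fintype V] (S : Finset V) :
    (Finset.univ.filter fun u : Fin (N + 1) → V =>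
      IsGoodWalk u ∧ Finset.univ.image u = S).card = surjGoodCount N S.card := by
  symm
  let ψ := S.equivFin
  let φ : Fin S.card → V := fun i => (ψ.symm i : V)
  have hφ : Function.Injective φ := Subtype.val_injective.comp ψ.symm.injective
  refine Finset.card_bij (fun u _ => φ ∘ u) ?_ ?_ ?_
  · intro u hu
    simp only [Finset.mem_filter, Finset.mem_univ, true_and] at hu ⊢
    refine ⟨(isGoodWalk_comp hφ u).2 hu.1, ?_⟩
    ext x
    simp only [Finset.mem_image, Finset.mem_univ, true_and, Function.comp]
    constructor
    · rintro ⟨i, rfl⟩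
      exact (ψ.symm (u i)).2
    · intro hx
      obtain ⟨i, hi⟩ := hu.2 (ψ ⟨x, hx⟩)
      exact ⟨i, by simp [φ, hi]⟩
  · intro u _ u' _ h
    exact hφ.comp_left h
  · intro u hu
    simp only [Finset.mem_filter, Finset.mem_univ, true_and] at hu
    have hmem : ∀ i, u i ∈ S := fun i => hu.2 ▸ Finset.mem_image_of_mem _ (Finset.mem_univ _)
    have hcomp : φ ∘ (fun i => ψ ⟨u i, hmem i⟩) = u := by
      ext i
      simp [φ]
    refine ⟨fun i => ψ ⟨u i, hmem i⟩, ?_, hcomp⟩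
    simp only [Finset.mem_filter, Finset.mem_univ, true_and]
    refine ⟨(isGoodWalk_comp hφ _).1 (hcomp.symm ▸ hu.1), fun j => ?_⟩
    have : (ψ.symm j : V) ∈ Finset.univ.image u := hu.2.symm ▸ (ψ.symm j).2
    obtain ⟨i, -, hi⟩ := Finset.mem_image.1 this
    exact ⟨i, by simp [hi]⟩

theorem card_goodWalk_card_image_eq [Fintype V] (v : ℕ) :
    (Finset.univ.filter fun u : Fin (N + 1) → V =>
      IsGoodWalk u ∧ (Finset.univ.image u).card = v).card =
      (Fintype.card V).choose v * surjGoodCount N v := by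
  rw [Finset.card_eq_sum_card_fiberwise (f := fun u => Finset.univ.image u)
    (t := Finset.univ.powersetCard v)]
  · rw [Finset.sum_congr rfl (g := fun _ => surjGoodCount N v)]
    · rw [Finset.sum_const, Finset.card_powersetCard, Finset.card_univ, smul_eq_mul]
    · intro S hS
      rw [Finset.mem_powersetCard] at hS
      rw [← hS.2, ← card_goodWalk_image_eq S, Finset.filter_filter]
      congr 1
      ext u
      simp only [Finset.mem_filter, Finset.mem_univ, true_and]
      constructor
      · rintro ⟨⟨h1, -⟩, h3⟩
        exact ⟨h1, h3⟩
      · rintro ⟨h1, h3⟩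
        exact ⟨⟨h1, by rw [h3]⟩, h3⟩
  · intro u hu
    simp only [Finset.coe_filter, Finset.mem_univ, true_and, Set.mem_ofPred_eq] at hu
    simp [Finset.mem_powersetCard, hu.2]

/-- In falling factorials: the one of `n` is at most `n * n ^ v`, while that of `2p` is at least `2p
* p ^ v`, since for `v ≤ p` its remaining `v` factors are all at least `p`. The hypothesis `nτ ≤ p`
compares the two. -/
theorem choose_mul_pow_le {n p v : ℕ} {τ : ℝ} (hτ : 0 ≤ τ) (hp : 0 < p) (hd : n * τ ≤ p)
    (hv : v ≤ p) :
    (n.choose (v + 1) : ℝ) * τ ^ v ≤ n / (2 * p) * ((2 * p).choose (v + 1)) := by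
  have h1 : (n.descFactorial (v + 1) : ℝ) ≤ n * (n : ℝ) ^ v := by
    have := n.descFactorial_le_pow (v + 1)
    rw [pow_succ'] at this
    exact_mod_cast this
  have h2 : (2 * p : ℝ) * (p : ℝ) ^ v ≤ (2 * p).descFactorial (v + 1) := by
    obtain ⟨q, rfl⟩ : ∃ q, p = q + 1 := ⟨p - 1, by omega⟩
    have h3 := (2 * q + 1).pow_sub_le_descFactorial v
    have h4 : (q + 1) ^ v ≤ (2 * q + 1 + 1 - v) ^ v := Nat.pow_le_pow_left (by omega) v
    have h5 : (2 * (q + 1)).descFactorial (v + 1) =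
        (2 * q + 1 + 1) * (2 * q + 1).descFactorial v := by
      rw [← Nat.succ_descFactorial_succ]; rfl
    have h6 : 2 * (q + 1) * (q + 1) ^ v ≤ (2 * (q + 1)).descFactorial (v + 1) := by
      rw [h5]
      exact Nat.mul_le_mul_left _ (h4.trans h3)
    exact_mod_cast h6
  rw [Nat.descFactorial_eq_factorial_mul_choose] at h1 h2
  push_cast at h1 h2
  have hf : (0 : ℝ) < (v + 1).factorial := by positivity
  have hp' : (0 : ℝ) < p := by exact_mod_cast hp
  have h7 : (n : ℝ) ^ v * τ ^ v ≤ (p : ℝ) ^ v := by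
    rw [← mul_pow]
    exact pow_le_pow_left₀ (by positivity) hd v
  rw [← mul_le_mul_iff_right₀ hf]
  calc ((v + 1).factorial : ℝ) * (n.choose (v + 1) * τ ^ v)
      = (((v + 1).factorial : ℝ) * n.choose (v + 1)) * τ ^ v := by ring
    _ ≤ (n * (n : ℝ) ^ v) * τ ^ v := by gcongr
    _ = n * ((n : ℝ) ^ v * τ ^ v) := by ring
    _ ≤ n * (p : ℝ) ^ v := by gcongr
    _ = n / (2 * p) * ((2 * p) * (p : ℝ) ^ v) := by field_simp
    _ ≤ n / (2 * p) * ((v + 1).factorial * (2 * p).choose (v + 1)) := by gcongr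
    _ = _ := by ring

theorem IsGoodWalk.card_image {p : ℕ} {u : Fin (2 * p + 1) → V} (hu : IsGoodWalk u) :
    (Finset.univ.image u).card - 1 ∈ Finset.range (p + 1) ∧
      (Finset.univ.image u).card = (Finset.univ.image u).card - 1 + 1 := by
  have h1 := card_image_le_card_walkEdges_add_one u
  have h2 := hu.two_mul_card_walkEdges_le
  have h3 : 0 < (Finset.univ.image u).card :=
    Finset.card_pos.2 ⟨u 0, Finset.mem_image_of_mem _ (Finset.mem_univ _)⟩
  rw [Finset.mem_range]
  omega

theorem filter_isGoodWalk_card_image [Fintype V] (p v : ℕ) :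
    (Finset.univ.filter fun u : Fin (2 * p + 1) → V => IsGoodWalk u).filter
        (fun u => (Finset.univ.image u).card - 1 = v) =
      Finset.univ.filter fun u : Fin (2 * p + 1) → V =>
        IsGoodWalk u ∧ (Finset.univ.image u).card = v + 1 := by
  rw [Finset.filter_filter]
  refine Finset.filter_congr fun u _ => and_congr_right fun hu => ?_
  have := hu.card_image.2
  omega

/-- Comparison of weighted good walks on `V` with good walks on `2 p` points. -/
theorem sum_goodWalk_pow_le [Fintype V] {p : ℕ} {τ : ℝ} (hτ : 0 ≤ τ) (hτ1 : τ ≤ 1) (hp : 0 < p)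
    (hd : Fintype.card V * τ ≤ p) :
    ∑ u : Fin (2 * p + 1) → V with IsGoodWalk u, τ ^ (walkEdges u).card ≤
      Fintype.card V / (2 * p) *
        (Finset.univ.filter fun u : Fin (2 * p + 1) → Fin (2 * p) => IsGoodWalk u).card := by
  have hR : ((Finset.univ.filter fun u : Fin (2 * p + 1) → Fin (2 * p) => IsGoodWalk u).card : ℝ) =
      ∑ v ∈ Finset.range (p + 1), ((2 * p).choose (v + 1) * surjGoodCount (2 * p) (v + 1) : ℝ) := by
    rw [Finset.card_eq_sum_card_fiberwise (f := fun u => (Finset.univ.image u).card - 1)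
      (t := Finset.range (p + 1))]
    · push_cast
      refine Finset.sum_congr rfl fun v _ => ?_
      rw [filter_isGoodWalk_card_image, card_goodWalk_card_image_eq, Fintype.card_fin]
      push_cast
      rfl
    · intro u hu
      simp only [Finset.coe_filter, Finset.mem_univ, true_and, Set.mem_ofPred_eq] at hu
      exact (IsGoodWalk.card_image hu).1
  rw [hR, Finset.mul_sum]
  rw [← Finset.sum_fiberwise_of_maps_to (g := fun u => (Finset.univ.image u).card - 1)
    (t := Finset.range (p + 1))
    (fun u hu => (IsGoodWalk.card_image (by simpa using hu)).1)]
  refine Finset.sum_le_sum fun v hv => ?_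
  rw [filter_isGoodWalk_card_image]
  calc ∑ u : Fin (2 * p + 1) → V with IsGoodWalk u ∧ (Finset.univ.image u).card = v + 1,
        τ ^ (walkEdges u).card
      ≤ ∑ u : Fin (2 * p + 1) → V with IsGoodWalk u ∧ (Finset.univ.image u).card = v + 1,
        τ ^ v := by
        refine Finset.sum_le_sum fun u hu => pow_le_pow_of_le_one hτ hτ1 ?_
        have h1 := card_image_le_card_walkEdges_add_one u
        have h2 := (Finset.mem_filter.1 hu).2.2
        omega
    _ = ((Fintype.card V).choose (v + 1) * τ ^ v) * surjGoodCount (2 * p) (v + 1) := by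
        rw [Finset.sum_const, card_goodWalk_card_image_eq, nsmul_eq_mul]
        push_cast
        ring
    _ ≤ (Fintype.card V / (2 * p) * ((2 * p).choose (v + 1))) *
          surjGoodCount (2 * p) (v + 1) := by
        refine mul_le_mul_of_nonneg_right (choose_mul_pow_le hτ hp hd ?_) (Nat.cast_nonneg _)
        rw [Finset.mem_range] at hv
        omega
    _ = _ := by ring

end Walks

/-! ### Traces of powers as sums over closed walks -/

section TracePow

variable {V : Type*} [Fintype V] [DecidableEq V]

/-- The arbitrary weight `F` on the endpoints makes the induction close: removing the first vertex
absorbs its matrix factor into a new weight. -/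
theorem sum_walk_eq_sum_pow (M : Matrix V V ℝ) :
    ∀ (N : ℕ) (F : V → V → ℝ),
      ∑ u : Fin (N + 1) → V, F (u 0) (u (Fin.last N)) * ∏ t : Fin N, M (u t.castSucc) (u t.succ) =
        ∑ i, ∑ j, F i j * (M ^ N) i j
  | 0, F => by
    rw [← (Equiv.funUnique (Fin 1) V).symm.sum_comp]
    simp [Matrix.one_apply]
  | N + 1, F => by
    rw [← (Fin.consEquiv fun _ => V).sum_comp, Fintype.sum_prod_type_right]
    have h : ∀ (u : Fin (N + 1) → V),
        ∑ x, F ((Fin.consEquiv fun _ => V) (x, u) 0)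
            ((Fin.consEquiv fun _ => V) (x, u) (Fin.last (N + 1))) *
          ∏ t : Fin (N + 1), M ((Fin.consEquiv fun _ => V) (x, u) t.castSucc)
            ((Fin.consEquiv fun _ => V) (x, u) t.succ) =
        (fun a b => ∑ x, F x b * M x a) (u 0) (u (Fin.last N)) *
          ∏ t : Fin N, M (u t.castSucc) (u t.succ) := by
      intro u
      rw [Finset.sum_mul]
      refine Finset.sum_congr rfl fun x _ => ?_
      rw [Fin.prod_univ_succ, ← mul_assoc]
      rfl
    rw [Finset.sum_congr rfl fun u _ => h u,
      sum_walk_eq_sum_pow M N (fun a b => ∑ x, F x b * M x a)]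
    simp only [pow_succ', Matrix.mul_apply, Finset.sum_mul, Finset.mul_sum]
    calc ∑ a, ∑ b, ∑ x, F x b * M x a * (M ^ N) a b
        = ∑ x, ∑ a, ∑ b, F x b * M x a * (M ^ N) a b := by
          rw [Finset.sum_congr rfl fun a _ => Finset.sum_comm, Finset.sum_comm]
      _ = ∑ x, ∑ b, ∑ a, F x b * (M x a * (M ^ N) a b) := by
          refine Finset.sum_congr rfl fun x _ => ?_
          rw [Finset.sum_comm]
          simp only [mul_assoc]

theorem prod_walkStep {N : ℕ} (w : Sym2 V → ℝ) (u : Fin (N + 1) → V) :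
    ∏ t, w (walkStep u t) = ∏ e, w e ^ edgeMult u e := by
  rw [← Finset.prod_fiberwise Finset.univ (walkStep u)]
  refine Finset.prod_congr rfl fun e _ => ?_
  rw [edgeMult, ← Finset.prod_const]
  refine Finset.prod_congr rfl fun t ht => ?_
  rw [(Finset.mem_filter.1 ht).2]

theorem trace_pow_eq_sum_walk (w : Sym2 V → ℝ) (N : ℕ) :
    ((Matrix.of fun i j => w s(i, j)) ^ N).trace =
      ∑ u : Fin (N + 1) → V with u 0 = u (Fin.last N), ∏ e, w e ^ edgeMult u e := by
  have h := sum_walk_eq_sum_pow (Matrix.of fun i j => w s(i, j)) N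
    (fun i j => if i = j then 1 else 0)
  simp only [ite_mul, one_mul, zero_mul, Finset.sum_ite_eq, Finset.mem_univ, if_true] at h
  rw [Matrix.trace]
  simp only [Matrix.diag_apply]
  rw [← h, Finset.sum_filter]
  refine Finset.sum_congr rfl fun u _ => ?_
  split_ifs
  · exact prod_walkStep w u
  · rfl

end TracePow

/-! ### The comparison ensemble with entries `2, -1, -1` -/

/-- The values of a centered variable all of whose moments of order at least two exceed one. -/
def skew : Fin 3 → ℝ := ![2, -1, -1]

/-- The symmetric matrix with independent skew entries, as a function of the outcome `s`. -/
def skewMatrix {r : ℕ} (s : Sym2 (Fin r) → Fin 3) : Matrix (Fin r) (Fin r) ℝ :=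
  Matrix.of fun i j => skew (s s(i, j))

theorem sum_skew_pow (k : ℕ) : ∑ c, skew c ^ k = 2 ^ k + 2 * (-1) ^ k := by
  simp [skew, Fin.sum_univ_three]
  ring

theorem three_le_sum_skew_pow {k : ℕ} (hk : k ≠ 1) : 3 ≤ ∑ c, skew c ^ k := by
  rw [sum_skew_pow]
  rcases Nat.even_or_odd k with h | h
  · rw [h.neg_one_pow]
    have : (1 : ℝ) ≤ 2 ^ k := one_le_pow₀ (by norm_num)
    linarith
  · rw [h.neg_one_pow]
    have h3 : 3 ≤ k := by
      obtain ⟨j, rfl⟩ := h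
      omega
    have : (2 : ℝ) ^ 3 ≤ 2 ^ k := pow_le_pow_right₀ (by norm_num) h3
    linarith

/-- Summing over outcomes factorizes over edges. A good walk yields a factor at least `3` on each
edge, multiplicity zero included; a closed walk that is not good has a factor `2 - 1 - 1 = 0` and
all other factors nonnegative. Hence the remaining walks may be dropped. -/
theorem card_goodWalk_le_sum_trace (r N : ℕ) :
    ((Finset.univ.filter fun u : Fin (N + 1) → Fin r => IsGoodWalk u).card : ℝ) *
        3 ^ Fintype.card (Sym2 (Fin r)) ≤
      ∑ s : Sym2 (Fin r) → Fin 3, (skewMatrix s ^ N).trace := by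
  have h : ∀ s : Sym2 (Fin r) → Fin 3, (skewMatrix s ^ N).trace =
      ∑ u : Fin (N + 1) → Fin r with u 0 = u (Fin.last N), ∏ e, skew (s e) ^ edgeMult u e :=
    fun s => trace_pow_eq_sum_walk (fun e => skew (s e)) N
  rw [Finset.sum_congr rfl fun s _ => h s, Finset.sum_comm]
  have h2 : ∀ u : Fin (N + 1) → Fin r,
      ∑ s : Sym2 (Fin r) → Fin 3, ∏ e, skew (s e) ^ edgeMult u e =
        ∏ e, ∑ c, skew c ^ edgeMult u e := by
    intro u
    rw [Finset.prod_univ_sum, Fintype.piFinset_univ]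
  rw [Finset.sum_congr rfl fun u _ => h2 u]
  rw [← nsmul_eq_mul, ← Finset.sum_const]
  have hsub : (Finset.univ.filter fun u : Fin (N + 1) → Fin r => IsGoodWalk u) ⊆
      Finset.univ.filter fun u : Fin (N + 1) → Fin r => u 0 = u (Fin.last N) := by
    intro u hu
    simp only [Finset.mem_filter, Finset.mem_univ, true_and] at hu ⊢
    exact hu.1
  refine le_trans (Finset.sum_le_sum fun u hu => ?_)
    (Finset.sum_le_sum_of_subset_of_nonneg hsub fun u _ _ => ?_)
  · rw [Finset.mem_filter] at hu
    rw [← Finset.card_univ, ← Finset.prod_const]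
    exact Finset.prod_le_prod (fun _ _ => by norm_num) fun e _ =>
      three_le_sum_skew_pow (hu.2.2 e)
  · refine Finset.prod_nonneg fun e _ => ?_
    by_cases h1 : edgeMult u e = 1
    · rw [h1, sum_skew_pow]; norm_num
    · exact (by norm_num : (0 : ℝ) ≤ 3).trans (three_le_sum_skew_pow h1)

/-! ### Operator norms, traces and nets -/

section Norms

variable {V : Type*} [Fintype V] [DecidableEq V]

theorem toEuclideanCLM_apply (M : Matrix V V ℝ) (x : EuclideanSpace ℝ V) (i : V) :
    (Matrix.toEuclideanCLM (𝕜 := ℝ) M x) i = ∑ j, M i j * x j := by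
  rw [Matrix.ofLp_toEuclideanCLM]
  rfl

theorem inner_toEuclideanCLM (M : Matrix V V ℝ) (x y : EuclideanSpace ℝ V) :
    inner ℝ y (Matrix.toEuclideanCLM (𝕜 := ℝ) M x) = ∑ i, ∑ j, M i j * (y i * x j) := by
  rw [PiLp.inner_apply]
  refine Finset.sum_congr rfl fun i _ => ?_
  rw [toEuclideanCLM_apply]
  simp only [inner, Finset.sum_mul, star_trivial]
  exact Finset.sum_congr rfl fun j _ => by ring

theorem trace_le_card_mul_norm (M : Matrix V V ℝ) :
    M.trace ≤ Fintype.card V * ‖Matrix.toEuclideanCLM (𝕜 := ℝ) M‖ := by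
  have h : ∀ i, M i i ≤ ‖Matrix.toEuclideanCLM (𝕜 := ℝ) M‖ := by
    intro i
    have h1 : M i i = inner ℝ (EuclideanSpace.single i (1 : ℝ))
        (Matrix.toEuclideanCLM (𝕜 := ℝ) M (EuclideanSpace.single i (1 : ℝ))) := by
      rw [inner_toEuclideanCLM]
      simp
    rw [h1]
    refine (real_inner_le_norm _ _).trans ?_
    have h2 := (Matrix.toEuclideanCLM (𝕜 := ℝ) M).le_opNorm (EuclideanSpace.single i (1 : ℝ))
    simpa using h2
  calc M.trace = ∑ i, M i i := rfl
    _ ≤ ∑ _i : V, ‖Matrix.toEuclideanCLM (𝕜 := ℝ) M‖ := Finset.sum_le_sum fun i _ => h i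
    _ = _ := by simp

theorem norm_sq_le_sum_sq (M : Matrix V V ℝ) :
    ‖Matrix.toEuclideanCLM (𝕜 := ℝ) M‖ ^ 2 ≤ ∑ i, ∑ j, M i j ^ 2 := by
  have h0 : 0 ≤ ∑ i, ∑ j, M i j ^ 2 :=
    Finset.sum_nonneg fun i _ => Finset.sum_nonneg fun j _ => sq_nonneg _
  have h : ‖Matrix.toEuclideanCLM (𝕜 := ℝ) M‖ ≤ √(∑ i, ∑ j, M i j ^ 2) := by
    refine ContinuousLinearMap.opNorm_le_bound _ (Real.sqrt_nonneg _) fun x => ?_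
    rw [← sq_le_sq₀ (norm_nonneg _) (by positivity), mul_pow, Real.sq_sqrt h0,
      EuclideanSpace.real_norm_sq_eq, EuclideanSpace.real_norm_sq_eq, Finset.sum_mul]
    refine Finset.sum_le_sum fun i _ => ?_
    rw [toEuclideanCLM_apply]
    exact Finset.sum_mul_sq_le_sq_mul_sq _ _ _
  calc _ ≤ √(∑ i, ∑ j, M i j ^ 2) ^ 2 := by gcongr
    _ = _ := Real.sq_sqrt h0

/-- For a self-adjoint operator `‖T ^ 2^k‖ = ‖T‖ ^ 2^k`; the operator norm of `M ^ 2^k` is then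
bounded by its Frobenius norm, whose square is a trace. This is why the moment order is later taken
to be a power of two. -/
theorem norm_pow_le_trace {M : Matrix V V ℝ} (hM : M.IsSymm) (k : ℕ) :
    ‖Matrix.toEuclideanCLM (𝕜 := ℝ) M‖ ^ (2 * 2 ^ k) ≤ (M ^ (2 * 2 ^ k)).trace := by
  have hsa : IsSelfAdjoint (Matrix.toEuclideanCLM (𝕜 := ℝ) M) := by
    rw [isSelfAdjoint_iff, ← map_star]
    congr 1
  have h1 := IsSelfAdjoint.norm_pow_two_pow
    (E := EuclideanSpace ℝ V →L[ℝ] EuclideanSpace ℝ V) hsa k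
  rw [mul_comm, pow_mul, ← h1, ← map_pow]
  refine (norm_sq_le_sum_sq _).trans (le_of_eq ?_)
  rw [pow_mul, sq (M ^ 2 ^ k), Matrix.trace]
  refine Finset.sum_congr rfl fun i _ => ?_
  rw [Matrix.diag_apply, Matrix.mul_apply]
  refine Finset.sum_congr rfl fun j _ => ?_
  rw [(hM.pow (2 ^ k)).apply, sq]

end Norms

/-- A maximal `1/2`-separated subset of the unit ball is a net. Dilated by two it is `1`-separated
in the ball of radius two, where the volume bound `5 ^ dim` applies. -/
theorem exists_half_net (E : Type*) [NormedAddCommGroup E] [NormedSpace ℝ E]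
    [FiniteDimensional ℝ E] :
    ∃ s : Finset E, (∀ x ∈ s, ‖x‖ ≤ 1) ∧ s.card ≤ 5 ^ Module.finrank ℝ E ∧
      ∀ x : E, ‖x‖ ≤ 1 → ∃ z ∈ s, ‖x - z‖ ≤ 1 / 2 := by
  classical
  let P : ℕ → Prop := fun k => ∃ s : Finset E, (∀ x ∈ s, ‖x‖ ≤ 1) ∧
    (∀ x ∈ s, ∀ y ∈ s, x ≠ y → 1 / 2 ≤ ‖x - y‖) ∧ s.card = k
  have hP0 : P 0 := ⟨∅, by simp, by simp, by simp⟩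
  have hbound : ∀ k, P k → k ≤ 5 ^ Module.finrank ℝ E := by
    rintro k ⟨s, h1, h2, rfl⟩
    have hinj : Function.Injective fun x : E => (2 : ℝ) • x :=
      smul_right_injective E (two_ne_zero)
    rw [← Finset.card_image_of_injective s hinj]
    refine Besicovitch.card_le_of_separated _ ?_ ?_
    · intro c hc
      obtain ⟨x, hx, rfl⟩ := Finset.mem_image.1 hc
      have := h1 x hx
      rw [norm_smul]
      norm_num
      linarith
    · intro c hc d hd hcd
      obtain ⟨x, hx, rfl⟩ := Finset.mem_image.1 hc
      obtain ⟨y, hy, rfl⟩ := Finset.mem_image.1 hd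
      have := h2 x hx y hy (fun h => hcd (by rw [h]))
      rw [← smul_sub, norm_smul]
      norm_num
      linarith
  obtain ⟨s, h1, h2, h3⟩ : P (Nat.findGreatest P (5 ^ Module.finrank ℝ E)) :=
    Nat.findGreatest_spec (Nat.zero_le _) hP0
  refine ⟨s, h1, by rw [h3]; exact Nat.findGreatest_le _, fun x hx => ?_⟩
  by_contra! hfar
  have hxs : x ∉ s := fun h => by
    have := hfar x h
    norm_num at this
  have hP : P (s.card + 1) := by
    refine ⟨insert x s, ?_, ?_, Finset.card_insert_of_notMem hxs⟩
    · intro y hy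
      rcases Finset.mem_insert.1 hy with rfl | hy
      · exact hx
      · exact h1 y hy
    · intro y hy z hz hyz
      rcases Finset.mem_insert.1 hy with hy' | hy' <;>
        rcases Finset.mem_insert.1 hz with hz' | hz'
      · exact absurd (hy'.trans hz'.symm) hyz
      · rw [hy']; exact (hfar z hz').le
      · rw [hz', norm_sub_rev]; exact (hfar y hy').le
      · exact h2 y hy' z hz' hyz
  have := Nat.le_findGreatest (P := P) (hbound _ hP) hP
  omega

/-- The operator norm is controlled by a bilinear form on a net. -/
theorem exists_norm_le_four_mul_inner {E : Type*} [NormedAddCommGroup E] [InnerProductSpace ℝ E]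
    [FiniteDimensional ℝ E] {s : Finset E} (hs : ∀ x : E, ‖x‖ ≤ 1 → ∃ z ∈ s, ‖x - z‖ ≤ 1 / 2)
    (T : E →L[ℝ] E) : ∃ x ∈ s, ∃ y ∈ s, ‖T‖ ≤ 4 * inner ℝ y (T x) := by
  obtain ⟨z₀, hz₀, -⟩ := hs 0 (by simp)
  obtain ⟨x, hx, hxmax⟩ := Finset.exists_max_image s (fun z => ‖T z‖) ⟨z₀, hz₀⟩
  obtain ⟨y, hy, hymax⟩ := Finset.exists_max_image s (fun z => inner ℝ z (T x)) ⟨z₀, hz₀⟩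
  refine ⟨x, hx, y, hy, ?_⟩
  -- Each of the two passages to the net, in the argument and in the dual vector, loses a factor
  -- two.
  have h1 : ‖T‖ ≤ ‖T x‖ + ‖T‖ / 2 := by
    refine ContinuousLinearMap.opNorm_le_of_unit_norm (by positivity) fun v hv => ?_
    obtain ⟨z, hz, hvz⟩ := hs v hv.le
    calc ‖T v‖ = ‖T z + T (v - z)‖ := by rw [← map_add]; congr 2; abel
      _ ≤ ‖T z‖ + ‖T (v - z)‖ := norm_add_le _ _
      _ ≤ ‖T x‖ + ‖T‖ * (1 / 2) := by
        gcongr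
        · exact hxmax z hz
        · exact (T.le_opNorm _).trans (by gcongr)
      _ = _ := by ring
  have h2 : ‖T x‖ ≤ inner ℝ y (T x) + ‖T x‖ / 2 := by
    rcases eq_or_ne (T x) 0 with h0 | h0
    · rw [h0]; simp
    · have hn : ‖T x‖ ≠ 0 := norm_ne_zero_iff.2 h0
      obtain ⟨z, hz, hvz⟩ := hs (‖T x‖⁻¹ • T x) (by
        rw [norm_smul, norm_inv, norm_norm, inv_mul_cancel₀ hn])
      calc ‖T x‖ = inner ℝ (‖T x‖⁻¹ • T x) (T x) := by
            rw [real_inner_smul_left, real_inner_self_eq_norm_sq]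
            field_simp
        _ = inner ℝ z (T x) + inner ℝ (‖T x‖⁻¹ • T x - z) (T x) := by
            rw [← inner_add_left]; congr 1; abel
        _ ≤ inner ℝ y (T x) + (1 / 2) * ‖T x‖ := by
            gcongr
            · exact hymax z hz
            · exact (real_inner_le_norm _ _).trans (by gcongr)
        _ = _ := by ring
  linarith

/-! ### Moments of the comparison ensemble -/

theorem exp_le_add_exp_sq (t : ℝ) : Real.exp t ≤ t + Real.exp (t ^ 2) := by
  have h := Real.add_one_le_exp (t ^ 2)
  rcases le_total |t| 1 with h1 | h1
  · have := (abs_le.1 (Real.abs_exp_sub_one_sub_id_le h1)).2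
    linarith
  · rcases le_total 0 t with h0 | h0
    · rw [abs_of_nonneg h0] at h1
      have : Real.exp t ≤ Real.exp (t ^ 2) := Real.exp_le_exp.2 (by nlinarith)
      linarith
    · rw [abs_of_nonpos h0] at h1
      have : Real.exp t ≤ 1 := Real.exp_le_one_iff.2 h0
      nlinarith

/-- In `exp t ≤ t + exp (t ^ 2)` the linear terms cancel over the three values because `skew` is
centered. -/
theorem sum_exp_skew_le (x : ℝ) : ∑ c, Real.exp (x * skew c) ≤ 3 * Real.exp (4 * x ^ 2) := by
  have h1 := exp_le_add_exp_sq (x * 2)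
  have h2 := exp_le_add_exp_sq (x * -1)
  have h3 : Real.exp ((x * 2) ^ 2) = Real.exp (4 * x ^ 2) := by ring_nf
  have h4 : Real.exp ((x * -1) ^ 2) ≤ Real.exp (4 * x ^ 2) :=
    Real.exp_le_exp.2 (by nlinarith [sq_nonneg x])
  have h5 : ∑ c, Real.exp (x * skew c) =
      Real.exp (x * 2) + Real.exp (x * -1) + Real.exp (x * -1) := Fin.sum_univ_three _
  linarith

theorem sum_exp_skew_linear_le {ι : Type*} [Fintype ι] [DecidableEq ι] (a : ι → ℝ) (l : ℝ) :
    ∑ s : ι → Fin 3, Real.exp (l * ∑ e, skew (s e) * a e) ≤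
      3 ^ Fintype.card ι * Real.exp (4 * l ^ 2 * ∑ e, a e ^ 2) := by
  have h : ∀ s : ι → Fin 3, Real.exp (l * ∑ e, skew (s e) * a e) =
      ∏ e, Real.exp (l * a e * skew (s e)) := by
    intro s
    rw [← Real.exp_sum, Finset.mul_sum]
    congr 1
    exact Finset.sum_congr rfl fun e _ => by ring
  have h2 := Finset.prod_univ_sum (fun _ : ι => (Finset.univ : Finset (Fin 3)))
    (fun e c => Real.exp (l * a e * skew c))
  rw [Fintype.piFinset_univ] at h2
  rw [Finset.sum_congr rfl fun s _ => h s, ← h2]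
  calc ∏ e, ∑ c, Real.exp (l * a e * skew c)
      ≤ ∏ e, 3 * Real.exp (4 * (l * a e) ^ 2) :=
        Finset.prod_le_prod (fun e _ => Finset.sum_nonneg fun c _ => (Real.exp_pos _).le)
          fun e _ => sum_exp_skew_le _
    _ = _ := by
      rw [Finset.prod_mul_distrib, Finset.prod_const, Finset.card_univ, ← Real.exp_sum]
      congr 2
      rw [Finset.mul_sum]
      exact Finset.sum_congr rfl fun e _ => by ring

theorem sum_sq_fiber_le {r : ℕ} (g : Fin r × Fin r → ℝ) :
    ∑ e : Sym2 (Fin r), (∑ q : Fin r × Fin r with s(q.1, q.2) = e, g q) ^ 2 ≤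
      2 * ∑ q, g q ^ 2 := by
  rw [← Finset.sum_fiberwise Finset.univ (fun q : Fin r × Fin r => s(q.1, q.2)), Finset.mul_sum]
  refine Finset.sum_le_sum fun e _ => ?_
  have hcard : (Finset.univ.filter fun q : Fin r × Fin r => s(q.1, q.2) = e).card ≤ 2 := by
    induction e using Sym2.ind with
    | _ i j =>
      refine (Finset.card_le_card (t := {(i, j), (j, i)}) ?_).trans Finset.card_le_two
      rintro ⟨a, b⟩ h
      simp only [Finset.mem_filter, Finset.mem_univ, true_and, Sym2.eq_iff] at h
      simp only [Finset.mem_insert, Finset.mem_singleton, Prod.mk.injEq]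
      exact h
  refine (sq_sum_le_card_mul_sum_sq).trans ?_
  exact mul_le_mul_of_nonneg_right (by exact_mod_cast hcard)
    (Finset.sum_nonneg fun _ _ => sq_nonneg _)

theorem sum_inner_skewMatrix_pow_le {r p : ℕ} (hp : 0 < p) (x y : EuclideanSpace ℝ (Fin r))
    (hx : ‖x‖ ≤ 1) (hy : ‖y‖ ≤ 1) :
    ∑ s, (inner ℝ y (Matrix.toEuclideanCLM (𝕜 := ℝ) (skewMatrix s) x)) ^ (2 * p) ≤
      2 * (4 * Real.exp 8 * p) ^ p * 3 ^ Fintype.card (Sym2 (Fin r)) := by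
  -- Grouping by unordered pairs turns the bilinear form into a linear form in independent
  -- variables. Each class has at most two ordered pairs, whence `∑ a e ^ 2 ≤ 2`.
  set a : Sym2 (Fin r) → ℝ := fun e => ∑ q : Fin r × Fin r with s(q.1, q.2) = e, y q.1 * x q.2
    with ha
  have ha2 : ∑ e, a e ^ 2 ≤ 2 := by
    refine (sum_sq_fiber_le _).trans ?_
    have h1 : ∑ q : Fin r × Fin r, (y q.1 * x q.2) ^ 2 = ‖y‖ ^ 2 * ‖x‖ ^ 2 := by
      rw [Fintype.sum_prod_type, EuclideanSpace.real_norm_sq_eq, EuclideanSpace.real_norm_sq_eq,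
        Finset.sum_mul_sum]
      simp only [mul_pow]
    rw [h1]
    have h2 : ‖y‖ ^ 2 ≤ 1 := pow_le_one₀ (norm_nonneg _) hy
    have h3 : ‖x‖ ^ 2 ≤ 1 := pow_le_one₀ (norm_nonneg _) hx
    have := mul_le_one₀ h2 (by positivity) h3
    linarith
  have hB : ∀ s : Sym2 (Fin r) → Fin 3,
      inner ℝ y (Matrix.toEuclideanCLM (𝕜 := ℝ) (skewMatrix s) x) = ∑ e, skew (s e) * a e := by
    intro s
    rw [inner_toEuclideanCLM, ← Fintype.sum_prod_type',
      ← Finset.sum_fiberwise Finset.univ (fun q : Fin r × Fin r => s(q.1, q.2))]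
    refine Finset.sum_congr rfl fun e _ => ?_
    rw [ha, Finset.mul_sum]
    refine Finset.sum_congr rfl fun q hq => ?_
    rw [skewMatrix, Matrix.of_apply, (Finset.mem_filter.1 hq).2]
  have hp' : (0 : ℝ) < p := by exact_mod_cast hp
  -- Moments are read off the exponential series at the scale `√p`, at which the variance proxy
  -- produces exactly `exp (4 * p * 2) = exp 8 ^ p`.
  have hpt : ∀ b : ℝ, b ^ (2 * p) ≤ (4 * p) ^ p * (Real.exp (√p * b) + Real.exp (-√p * b)) := by
    intro b
    have h1 := Real.pow_div_factorial_le_exp (x := |√p * b|) (abs_nonneg _) (2 * p)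
    have h2 : Real.exp |√p * b| ≤ Real.exp (√p * b) + Real.exp (-√p * b) := by
      rcases abs_choice (√p * b) with h | h
      · rw [h]; linarith [Real.exp_pos (-√p * b)]
      · rw [h, neg_mul]; linarith [Real.exp_pos (√p * b)]
    have h3 : |√p * b| ^ (2 * p) = (p : ℝ) ^ p * b ^ (2 * p) := by
      rw [pow_mul, sq_abs, mul_pow, mul_pow, Real.sq_sqrt hp'.le, ← pow_mul]
    have h4 : ((2 * p).factorial : ℝ) ≤ (4 * p) ^ p * (p : ℝ) ^ p := by
      have h5 : ((2 * p).factorial : ℝ) ≤ ((2 * p : ℕ) : ℝ) ^ (2 * p) := by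
        exact_mod_cast Nat.factorial_le_pow (2 * p)
      refine h5.trans (le_of_eq ?_)
      rw [pow_mul, ← mul_pow]
      push_cast
      congr 1
      ring
    have hf : (0 : ℝ) < (2 * p).factorial := by positivity
    rw [h3, div_le_iff₀ hf] at h1
    have hpp : (0 : ℝ) < (p : ℝ) ^ p := by positivity
    rw [← mul_le_mul_iff_right₀ hpp]
    calc (p : ℝ) ^ p * b ^ (2 * p) ≤ Real.exp |√p * b| * (2 * p).factorial := h1
      _ ≤ (Real.exp (√p * b) + Real.exp (-√p * b)) * ((4 * p) ^ p * (p : ℝ) ^ p) := by gcongr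
      _ = _ := by ring
  have hexp : ∀ l : ℝ, l ^ 2 = p →
      ∑ s : Sym2 (Fin r) → Fin 3, Real.exp (l * ∑ e, skew (s e) * a e) ≤
        3 ^ Fintype.card (Sym2 (Fin r)) * Real.exp 8 ^ p := by
    intro l hl
    refine (sum_exp_skew_linear_le a l).trans ?_
    rw [← Real.exp_nat_mul]
    refine mul_le_mul_of_nonneg_left (Real.exp_le_exp.2 ?_) (by positivity)
    rw [hl]
    nlinarith
  have e1 := hexp (√p) (Real.sq_sqrt hp'.le)
  have e2 := hexp (-√p) (by rw [neg_sq, Real.sq_sqrt hp'.le])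
  calc ∑ s, (inner ℝ y (Matrix.toEuclideanCLM (𝕜 := ℝ) (skewMatrix s) x)) ^ (2 * p)
      ≤ ∑ s : Sym2 (Fin r) → Fin 3, (4 * p) ^ p * (Real.exp (√p * ∑ e, skew (s e) * a e) +
          Real.exp (-√p * ∑ e, skew (s e) * a e)) := by
        refine Finset.sum_le_sum fun s _ => ?_
        rw [hB]
        exact hpt _
    _ ≤ (4 * p) ^ p * (3 ^ Fintype.card (Sym2 (Fin r)) * Real.exp 8 ^ p +
          3 ^ Fintype.card (Sym2 (Fin r)) * Real.exp 8 ^ p) := by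
        rw [← Finset.mul_sum, Finset.sum_add_distrib]
        gcongr
    _ = _ := by
        rw [mul_right_comm (4 : ℝ), mul_pow _ (Real.exp 8)]
        ring

theorem card_goodWalk_le {p : ℕ} (hp : 0 < p) :
    ((Finset.univ.filter fun u : Fin (2 * p + 1) → Fin (2 * p) => IsGoodWalk u).card : ℝ) ≤
      4 * p * (40000 * Real.exp 8 * p) ^ p := by
  obtain ⟨S, hS1, hScard, hS⟩ := exists_half_net (EuclideanSpace ℝ (Fin (2 * p)))
  rw [finrank_euclideanSpace_fin] at hScard
  have hScard' : (S.card : ℝ) ≤ 5 ^ (2 * p) := by exact_mod_cast hScard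
  have htr : ∀ s : Sym2 (Fin (2 * p)) → Fin 3, (skewMatrix s ^ (2 * p)).trace ≤
      (2 * p) * (16 ^ p * ∑ x ∈ S, ∑ y ∈ S,
        (inner ℝ y (Matrix.toEuclideanCLM (𝕜 := ℝ) (skewMatrix s) x)) ^ (2 * p)) := by
    intro s
    refine (trace_le_card_mul_norm _).trans ?_
    rw [Fintype.card_fin]
    push_cast
    gcongr
    obtain ⟨x, hx, y, hy, hxy⟩ :=
      exists_norm_le_four_mul_inner hS (Matrix.toEuclideanCLM (𝕜 := ℝ) (skewMatrix s))
    rw [map_pow]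
    have hnn : ∀ x y : EuclideanSpace ℝ (Fin (2 * p)),
        0 ≤ (inner ℝ y (Matrix.toEuclideanCLM (𝕜 := ℝ) (skewMatrix s) x)) ^ (2 * p) :=
      fun x y => (even_two_mul p).pow_nonneg _
    calc _ ≤ ‖Matrix.toEuclideanCLM (𝕜 := ℝ) (skewMatrix s)‖ ^ (2 * p) := norm_pow_le' _ (by omega)
      _ ≤ (4 * inner ℝ y (Matrix.toEuclideanCLM (𝕜 := ℝ) (skewMatrix s) x)) ^ (2 * p) := by gcongr
      _ = 16 ^ p * (inner ℝ y (Matrix.toEuclideanCLM (𝕜 := ℝ) (skewMatrix s) x)) ^ (2 * p) := by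
          rw [mul_pow, pow_mul]; norm_num
      _ ≤ _ := by
          gcongr
          refine le_trans ?_ (Finset.single_le_sum (fun x _ => Finset.sum_nonneg fun y _ => hnn x y)
            hx)
          exact Finset.single_le_sum (f := fun y => (inner ℝ y
            (Matrix.toEuclideanCLM (𝕜 := ℝ) (skewMatrix s) x)) ^ (2 * p)) (fun y _ => hnn x y) hy
  set c3 : ℝ := 3 ^ Fintype.card (Sym2 (Fin (2 * p))) with hc3
  have hc3pos : 0 < c3 := by positivity
  have hmain := card_goodWalk_le_sum_trace (2 * p) (2 * p)
  rw [← mul_le_mul_iff_left₀ hc3pos]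
  refine hmain.trans ?_
  calc ∑ s, (skewMatrix s ^ (2 * p)).trace
      ≤ ∑ s : Sym2 (Fin (2 * p)) → Fin 3, (2 * p) * (16 ^ p * ∑ x ∈ S, ∑ y ∈ S,
        (inner ℝ y (Matrix.toEuclideanCLM (𝕜 := ℝ) (skewMatrix s) x)) ^ (2 * p)) :=
        Finset.sum_le_sum fun s _ => htr s
    _ = (2 * p) * (16 ^ p * ∑ x ∈ S, ∑ y ∈ S, ∑ s : Sym2 (Fin (2 * p)) → Fin 3,
        (inner ℝ y (Matrix.toEuclideanCLM (𝕜 := ℝ) (skewMatrix s) x)) ^ (2 * p)) := by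
        rw [← Finset.mul_sum, ← Finset.mul_sum, Finset.sum_comm]
        congr 3
        ext x
        rw [Finset.sum_comm]
    _ ≤ (2 * p) * (16 ^ p * ∑ x ∈ S, ∑ y ∈ S, 2 * (4 * Real.exp 8 * p) ^ p * c3) := by
        refine mul_le_mul_of_nonneg_left (mul_le_mul_of_nonneg_left ?_ (by positivity))
          (by positivity)
        exact Finset.sum_le_sum fun x hx => Finset.sum_le_sum fun y hy =>
          sum_inner_skewMatrix_pow_le hp x y (hS1 x hx) (hS1 y hy)
    _ = (2 * p) * (16 ^ p * (S.card * (S.card * (2 * (4 * Real.exp 8 * p) ^ p * c3)))) := by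
        simp only [Finset.sum_const, nsmul_eq_mul]
    _ ≤ (2 * p) * (16 ^ p * (5 ^ (2 * p) * (5 ^ (2 * p) *
          (2 * (4 * Real.exp 8 * p) ^ p * c3)))) := by
        gcongr
    -- The constant is `40000 = 16 * 25 * 25 * 4`: the net factor `4` squared, the size `5 ^ (2p)`
    -- of the net for each of the two vectors, and the moment bound for the bilinear form.
    _ = 4 * p * (40000 * Real.exp 8 * p) ^ p * c3 := by
        have h : (40000 * Real.exp 8 * p : ℝ) ^ p =
            16 ^ p * (5 ^ (2 * p) * (5 ^ (2 * p) * (4 * Real.exp 8 * p) ^ p)) := by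
          rw [pow_mul, ← mul_pow, ← mul_pow, ← mul_pow]
          congr 1
          ring
        rw [h]
        ring

/-! ### Operator norm concentration -/

/-- `W` is a random symmetric matrix with zero diagonal and centered independent entries bounded by
one, of variance at most `τ`. The order on the indices, used to list each off-diagonal entry once,
is induced by the map `f`. -/
structure IsCenteredNoise {Ω : Type*} [MeasurableSpace Ω] (μ : Measure Ω) {V L : Type*} [LT L]
    (f : V → L) (τ : ℝ) (W : Ω → Matrix V V ℝ) : Prop where
  measurable : ∀ i j, Measurable fun ω => W ω i j
  symm : ∀ ω, (W ω).IsSymm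
  diag : ∀ ω i, W ω i i = 0
  abs_le_one : ∀ ω i j, |W ω i j| ≤ 1
  integral_eq_zero : ∀ i j, ∫ ω, W ω i j ∂μ = 0
  integral_sq_le : ∀ i j, ∫ ω, W ω i j ^ 2 ∂μ ≤ τ
  indep : iIndepFun (fun (e : {e : V × V // f e.1 < f e.2}) (ω : Ω) => W ω e.1.1 e.1.2) μ

/-- Walks see unordered pairs, independence is stated for increasing ordered pairs; this splitting
passes from one indexing to the other. -/
theorem prod_sym2_eq_mul {V L : Type*} [Fintype V] [DecidableEq V] [LinearOrder L] {f : V → L}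
    (hf : Function.Injective f) (F : Sym2 V → ℝ) :
    ∏ e, F e = (∏ q : {e : V × V // f e.1 < f e.2}, F s(q.1.1, q.1.2)) * ∏ i, F s(i, i) := by
  classical
  rw [← Finset.prod_filter_mul_prod_filter_not Finset.univ (fun e : Sym2 V => ¬ e.IsDiag)]
  congr 1
  · symm
    refine Finset.prod_nbij (fun q => s(q.1.1, q.1.2)) ?_ ?_ ?_ fun _ _ => rfl
    · rintro ⟨⟨i, j⟩, h⟩ -
      simp only [Finset.mem_filter, Finset.mem_univ, true_and, Sym2.mk_isDiag_iff]
      exact fun hij => h.ne (by rw [hij])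
    · rintro ⟨⟨i, j⟩, h⟩ - ⟨⟨i', j'⟩, h'⟩ - heq
      simp only [Sym2.eq_iff] at heq
      rcases heq with ⟨rfl, rfl⟩ | ⟨rfl, rfl⟩
      · rfl
      · exact absurd h h'.not_gt
    · intro e he
      induction e using Sym2.ind with
      | _ i j =>
        have hij : i ≠ j := by simpa using he
        rcases lt_or_gt_of_ne (hf.ne hij) with h | h
        · exact ⟨⟨(i, j), h⟩, by simp, rfl⟩
        · exact ⟨⟨(j, i), h⟩, by simp, Sym2.eq_swap⟩
  · symm
    refine Finset.prod_nbij (fun i => s(i, i)) ?_ ?_ ?_ fun _ _ => rfl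
    · intro i _
      simp
    · intro i _ j _ h
      simpa using h
    · intro e he
      induction e using Sym2.ind with
      | _ i j =>
        have hij : i = j := by simpa using he
        subst hij
        exact ⟨i, by simp, rfl⟩

/-! ### Trace moments of centered noise. -/

namespace IsCenteredNoise

variable {Ω : Type*} [MeasurableSpace Ω] {μ : Measure Ω} {V L : Type*} [LinearOrder L]
  {f : V → L} {τ : ℝ}
  {W : Ω → Matrix V V ℝ}

/-- The entries of a symmetric noise matrix, indexed by unordered pairs. -/
def entry (hW : IsCenteredNoise μ f τ W) (ω : Ω) : Sym2 V → ℝ :=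
  Sym2.lift ⟨fun i j => W ω i j, fun i j => ((hW.symm ω).apply i j).symm⟩

theorem entry_mk (hW : IsCenteredNoise μ f τ W) (ω : Ω) (i j : V) :
    hW.entry ω s(i, j) = W ω i j := rfl

theorem measurable_entry (hW : IsCenteredNoise μ f τ W) (e : Sym2 V) :
    Measurable fun ω => hW.entry ω e := by
  induction e using Sym2.ind with
  | _ i j => exact hW.measurable i j

theorem abs_entry_le (hW : IsCenteredNoise μ f τ W) (ω : Ω) (e : Sym2 V) :
    |hW.entry ω e| ≤ 1 := by
  induction e using Sym2.ind with
  | _ i j => exact hW.abs_le_one ω i j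

theorem integral_entry (hW : IsCenteredNoise μ f τ W) (e : Sym2 V) :
    ∫ ω, hW.entry ω e ∂μ = 0 := by
  induction e using Sym2.ind with
  | _ i j => exact hW.integral_eq_zero i j

theorem matrix_eq (hW : IsCenteredNoise μ f τ W) (ω : Ω) :
    W ω = Matrix.of fun i j => hW.entry ω s(i, j) := rfl

variable [IsProbabilityMeasure μ]

theorem abs_integral_entry_pow_le (hW : IsCenteredNoise μ f τ W) (e : Sym2 V) {k : ℕ}
    (hk : 2 ≤ k) : |∫ ω, hW.entry ω e ^ k ∂μ| ≤ τ := by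
  have hsq : ∫ ω, hW.entry ω e ^ 2 ∂μ ≤ τ := by
    induction e using Sym2.ind with
    | _ i j => exact hW.integral_sq_le i j
  have hInt : ∀ k : ℕ, Integrable (fun ω => |hW.entry ω e| ^ k) μ := fun k => by
    refine Integrable.of_bound (C := 1)
      (((hW.measurable_entry e).norm).pow_const k).aestronglyMeasurable
      (Filter.Eventually.of_forall fun ω => ?_)
    rw [Real.norm_eq_abs, abs_pow, abs_abs]
    exact pow_le_one₀ (abs_nonneg _) (hW.abs_entry_le ω e)
  refine (abs_integral_le_integral_abs).trans (le_trans ?_ hsq)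
  simp_rw [abs_pow, ← sq_abs (hW.entry _ e)]
  exact integral_mono (hInt k) (hInt 2) fun ω =>
    pow_le_pow_of_le_one (abs_nonneg _) (hW.abs_entry_le ω e) hk

variable [Fintype V]

theorem integrable_prod_entry_pow (hW : IsCenteredNoise μ f τ W) (k : Sym2 V → ℕ) :
    Integrable (fun ω => ∏ e, hW.entry ω e ^ k e) μ := by
  refine Integrable.of_bound (C := 1)
    (Finset.measurable_fun_prod _ fun e _ =>
      (hW.measurable_entry e).pow_const _).aestronglyMeasurable
    (Filter.Eventually.of_forall fun ω => ?_)
  rw [Real.norm_eq_abs, Finset.abs_prod]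
  refine Finset.prod_le_one (fun _ _ => abs_nonneg _) fun e _ => ?_
  rw [abs_pow]
  exact pow_le_one₀ (abs_nonneg _) (hW.abs_entry_le ω e)

variable [DecidableEq V]

theorem integral_prod_entry_pow (hf : Function.Injective f) (hW : IsCenteredNoise μ f τ W)
    (k : Sym2 V → ℕ) :
    ∫ ω, ∏ e, hW.entry ω e ^ k e ∂μ = ∏ e, ∫ ω, hW.entry ω e ^ k e ∂μ := by
  classical
  rw [prod_sym2_eq_mul hf fun e => ∫ ω, hW.entry ω e ^ k e ∂μ]
  simp_rw [prod_sym2_eq_mul hf fun e => hW.entry _ e ^ k e, entry_mk, hW.diag]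
  rw [integral_mul_const]
  congr 1
  · exact hW.indep.integral_fun_prod_comp (f := fun q x => x ^ k s(q.1.1, q.1.2))
      (fun q => (hW.measurable _ _).aemeasurable)
      fun q => (measurable_id.pow_const _).aestronglyMeasurable
  · simp

theorem integrable_trace_pow (hW : IsCenteredNoise μ f τ W) (N : ℕ) :
    Integrable (fun ω => (W ω ^ N).trace) μ := by
  simp_rw [hW.matrix_eq, trace_pow_eq_sum_walk]
  exact integrable_finsetSum _ fun u _ => hW.integrable_prod_entry_pow _

theorem integral_trace_pow_le_sum (hf : Function.Injective f) (hW : IsCenteredNoise μ f τ W)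
    (N : ℕ) :
    ∫ ω, (W ω ^ N).trace ∂μ ≤
      ∑ u : Fin (N + 1) → V with IsGoodWalk u, τ ^ (walkEdges u).card := by
  simp_rw [hW.matrix_eq, trace_pow_eq_sum_walk]
  rw [integral_finsetSum _ fun u _ => hW.integrable_prod_entry_pow _]
  have hsplit : (Finset.univ.filter fun u : Fin (N + 1) → V => IsGoodWalk u) =
      (Finset.univ.filter fun u : Fin (N + 1) → V => u 0 = u (Fin.last N)).filter
        (fun u => IsGoodWalk u) := by
    rw [Finset.filter_filter]
    refine Finset.filter_congr fun u _ => ⟨fun h => ⟨h.1, h⟩, fun h => h.2⟩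
  rw [hsplit]
  refine le_of_le_of_eq ?_ (Finset.sum_filter _ _).symm
  refine Finset.sum_le_sum fun u hu => ?_
  rw [hW.integral_prod_entry_pow hf]
  split_ifs with hgood
  · refine (le_abs_self _).trans ?_
    rw [Finset.abs_prod, ← Finset.prod_const,
      ← Finset.prod_subset (Finset.subset_univ (walkEdges u))]
    · refine Finset.prod_le_prod (fun _ _ => abs_nonneg _) fun e he =>
        hW.abs_integral_entry_pow_le e ?_
      have h0 : 0 < edgeMult u e := by
        obtain ⟨t, -, ht⟩ := Finset.mem_image.1 he
        exact Finset.card_pos.2 ⟨t, by simpa using ht⟩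
      have := hgood.2 e
      omega
    · intro e _ he
      have h0 : edgeMult u e = 0 := by
        rw [edgeMult, Finset.card_eq_zero, Finset.filter_eq_empty_iff]
        intro t _ ht
        exact he (Finset.mem_image.2 ⟨t, Finset.mem_univ _, ht⟩)
      rw [h0]
      simp
  · have : ∃ e, edgeMult u e = 1 := by
      by_contra! h
      exact hgood ⟨(Finset.mem_filter.1 hu).2, h⟩
    obtain ⟨e, he⟩ := this
    refine le_of_eq (Finset.prod_eq_zero (Finset.mem_univ e) ?_)
    rw [he]
    simpa using hW.integral_entry e

theorem integral_trace_pow_le (hf : Function.Injective f) (hW : IsCenteredNoise μ f τ W)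
    (hτ : 0 ≤ τ) (hτ1 : τ ≤ 1) {p : ℕ} (hp : 0 < p) (hd : Fintype.card V * τ ≤ p) :
    ∫ ω, (W ω ^ (2 * p)).trace ∂μ ≤ 2 * Fintype.card V * (40000 * Real.exp 8 * p) ^ p := by
  have hp' : (0 : ℝ) < p := by exact_mod_cast hp
  calc _ ≤ _ := hW.integral_trace_pow_le_sum hf (2 * p)
    _ ≤ _ := sum_goodWalk_pow_le hτ hτ1 hp hd
    _ ≤ Fintype.card V / (2 * p) * (4 * p * (40000 * Real.exp 8 * p) ^ p) := by
        gcongr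
        exact card_goodWalk_le hp
    _ = _ := by field_simp; ring

end IsCenteredNoise

/-- The absolute constant in the operator norm bound for centered noise. -/
def noiseConst : ℝ := √(160000 * Real.exp 11)

theorem exists_two_pow_near {d : ℝ} (hd : 1 / 2 ≤ d) :
    ∃ k : ℕ, d ≤ (2 ^ k : ℕ) ∧ ((2 ^ k : ℕ) : ℝ) ≤ 4 * d := by
  rcases le_total d 1 with h | h
  · exact ⟨0, by simpa using h, by norm_num; linarith⟩
  · obtain ⟨k, h1, h2⟩ := exists_nat_pow_near h (one_lt_two)
    refine ⟨k + 1, by push_cast; exact h2.le, ?_⟩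
    push_cast
    rw [pow_succ]
    linarith

/-- Sharp operator norm concentration of a sparse centered symmetric matrix. -/
theorem IsCenteredNoise.measureReal_lt_norm_le {Ω : Type*} [MeasurableSpace Ω] {μ : Measure Ω}
    [IsProbabilityMeasure μ] {V L : Type*} [Fintype V] [DecidableEq V] [LinearOrder L] {f : V → L}
    {τ : ℝ} {W : Ω → Matrix V V ℝ} (hf : Function.Injective f) (hW : IsCenteredNoise μ f τ W)
    (hτ : 0 ≤ τ) (hτ1 : τ ≤ 1) {n : ℕ} (hn : 0 < n) (hcard : Fintype.card V = n)
    (hlog : Real.log n ≤ n * τ) :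
    μ.real {ω | noiseConst * √(n * τ) < ‖Matrix.toEuclideanCLM (𝕜 := ℝ) (W ω)‖} ≤ (n : ℝ)⁻¹ := by
  rcases Nat.lt_or_ge n 2 with hn2 | hn2
  · obtain rfl : n = 1 := by omega
    simp
  have hn2' : (2 : ℝ) ≤ n := by exact_mod_cast hn2
  have hd : 1 / 2 ≤ n * τ := by
    have h1 : Real.log 2 ≤ Real.log n := Real.log_le_log (by norm_num) hn2'
    linarith [Real.log_two_gt_d9]
  -- The moment parameter `p = 2 ^ k` satisfies `nτ ≤ p ≤ 4nτ`. In `noiseConst ^ 2 = 4 * 40000 * exp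
  -- 8 * exp 3`, the `4` comes from this rounding and `exp 3` from Markov: `exp (3p) ≥ n ^ 3` leaves
  -- probability at most `2 / n ^ 2 ≤ 1 / n`.
  obtain ⟨k, hk1, hk2⟩ := exists_two_pow_near hd
  have hp : 0 < 2 ^ k := by positivity
  have hmom := hW.integral_trace_pow_le hf hτ hτ1 hp (by rw [hcard]; exact hk1)
  rw [hcard] at hmom
  set p := 2 ^ k with hpdef
  have hp' : (0 : ℝ) < p := by exact_mod_cast hp
  set B : ℝ := 40000 * Real.exp 8 * p with hB
  have hBpos : 0 < B := by positivity
  have hnn : ∀ ω, 0 ≤ (W ω ^ (2 * p)).trace := fun ω =>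
    le_trans (by positivity) (norm_pow_le_trace (hW.symm ω) k)
  have hmarkov := mul_meas_ge_le_integral_of_nonneg (Filter.Eventually.of_forall hnn)
    (hW.integrable_trace_pow (2 * p)) ((Real.exp 3 * B) ^ p)
  have hsub : {ω | noiseConst * √(n * τ) < ‖Matrix.toEuclideanCLM (𝕜 := ℝ) (W ω)‖} ⊆
      {ω | (Real.exp 3 * B) ^ p ≤ (W ω ^ (2 * p)).trace} := by
    intro ω hω
    simp only [Set.mem_ofPred_eq] at hω ⊢
    refine le_trans ?_ (norm_pow_le_trace (hW.symm ω) k)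
    rw [pow_mul]
    refine pow_le_pow_left₀ (by positivity) ?_ p
    have h1 : Real.exp 3 * B ≤ (noiseConst * √(n * τ)) ^ 2 := by
      rw [mul_pow, noiseConst, Real.sq_sqrt (by positivity), Real.sq_sqrt (by positivity), hB]
      have h2 : Real.exp 11 = Real.exp 3 * Real.exp 8 := by rw [← Real.exp_add]; norm_num
      rw [h2]
      calc Real.exp 3 * (40000 * Real.exp 8 * p) = 40000 * (Real.exp 3 * Real.exp 8) * p := by ring
        _ ≤ 40000 * (Real.exp 3 * Real.exp 8) * (4 * (n * τ)) := by gcongr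
        _ = _ := by ring
    refine h1.trans (pow_le_pow_left₀ ?_ hω.le 2)
    rw [noiseConst]
    positivity
  refine (measureReal_mono hsub (measure_ne_top _ _)).trans ?_
  set q := μ.real {ω | (Real.exp 3 * B) ^ p ≤ (W ω ^ (2 * p)).trace} with hq
  have h3 : (Real.exp 3) ^ p * q ≤ 2 * n := by
    have h4 := hmarkov.trans hmom
    rw [mul_pow] at h4
    have hBp : 0 < B ^ p := by positivity
    rw [← mul_le_mul_iff_left₀ hBp]
    linarith
  have h5 : (n : ℝ) ^ 3 ≤ Real.exp 3 ^ p := by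
    rw [← Real.exp_nat_mul]
    calc (n : ℝ) ^ 3 = Real.exp (3 * Real.log n) := by
          rw [mul_comm, Real.exp_mul, Real.exp_log (by linarith)]
          norm_cast
      _ ≤ _ := Real.exp_le_exp.2 (by linarith)
  have hq0 : 0 ≤ q := measureReal_nonneg
  have h6 : (n : ℝ) ^ 3 * q ≤ 2 * n := (mul_le_mul_of_nonneg_right h5 hq0).trans h3
  have hn0 : (0 : ℝ) < n := by linarith
  rw [← one_div, le_div_iff₀ hn0]
  have h7 : n ^ 2 * q ≤ 2 := by
    rw [← mul_le_mul_iff_right₀ hn0]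
    nlinarith
  nlinarith [mul_nonneg hn0.le hq0]

/-! ### Deterministic optimality of the cluster matrix -/

open scoped MatrixOrder Matrix.Norms.L2Operator in
-- Factor `Y = Bᴴ * B`: both sides become sums over the rows of `B`, and each row gives one
-- quadratic form of `M`.
theorem trace_mul_le_norm_mul_trace {V : Type*} [Fintype V] [DecidableEq V] (M : Matrix V V ℝ)
    {Y : Matrix V V ℝ} (hY : Y.PosSemidef) :
    (M * Y).trace ≤ ‖Matrix.toEuclideanCLM (𝕜 := ℝ) M‖ * Y.trace := by
  obtain ⟨B, rfl⟩ := CStarAlgebra.nonneg_iff_eq_star_mul_self.1 hY.nonneg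
  rw [Matrix.star_eq_conjTranspose]
  have hnorm : ∀ x : V → ℝ, ∑ i, ∑ j, M i j * (x i * x j) ≤
      ‖Matrix.toEuclideanCLM (𝕜 := ℝ) M‖ * ∑ i, x i ^ 2 := by
    intro x
    have h1 := inner_toEuclideanCLM M (WithLp.toLp 2 x) (WithLp.toLp 2 x)
    have h2 := real_inner_le_norm (WithLp.toLp 2 x)
      (Matrix.toEuclideanCLM (𝕜 := ℝ) M (WithLp.toLp 2 x))
    have h3 := (Matrix.toEuclideanCLM (𝕜 := ℝ) M).le_opNorm (WithLp.toLp 2 x)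
    have h4 := EuclideanSpace.real_norm_sq_eq (WithLp.toLp 2 x)
    simp only at h1 h4
    rw [← h1, ← h4]
    nlinarith [norm_nonneg (WithLp.toLp 2 x)]
  have h1 : (M * (Bᴴ * B)).trace = ∑ c, ∑ i, ∑ j, M i j * (B c i * B c j) := by
    simp only [Matrix.trace, Matrix.diag_apply, Matrix.mul_apply, Matrix.conjTranspose_apply,
      star_trivial, Finset.mul_sum]
    rw [Finset.sum_congr rfl fun i _ => Finset.sum_comm, Finset.sum_comm]
    exact Finset.sum_congr rfl fun c _ => Finset.sum_congr rfl fun i _ =>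
      Finset.sum_congr rfl fun j _ => by ring
  have h2 : (Bᴴ * B).trace = ∑ c, ∑ i, B c i ^ 2 := by
    simp only [Matrix.trace, Matrix.diag_apply, Matrix.mul_apply, Matrix.conjTranspose_apply,
      star_trivial, sq]
    rw [Finset.sum_comm]
  rw [h1, h2, Finset.mul_sum]
  exact Finset.sum_le_sum fun c _ => hnorm (B c)

theorem trace_mul_eq_sum {V : Type*} [Fintype V] (M : Matrix V V ℝ) {D : Matrix V V ℝ}
    (hD : D.IsSymm) : (M * D).trace = ∑ i, ∑ j, M i j * D i j := by
  simp only [Matrix.trace, Matrix.diag_apply, Matrix.mul_apply]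
  exact Finset.sum_congr rfl fun i _ => Finset.sum_congr rfl fun j _ => by rw [hD.apply]

section Deterministic

variable {K m : ℕ}

theorem clusterMatrix_apply (i j : Fin K × Fin m) :
    clusterMatrix K m i j = if i.1 = j.1 then 1 else 0 := by
  obtain ⟨k, a⟩ := i
  obtain ⟨l, b⟩ := j
  simp [clusterMatrix, Matrix.kroneckerMap_apply, Matrix.one_apply]

theorem sum_eq_sum_block (i : Fin K × Fin m) (g : Fin K × Fin m → ℝ) :
    ∑ j, (if i.1 = j.1 then g j else 0) = ∑ b, g (i.1, b) := by
  rw [Fintype.sum_prod_type_right]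
  exact Finset.sum_congr rfl fun b _ => by simp

theorem clusterMatrix_isSymm : (clusterMatrix K m).IsSymm := by
  ext i j
  simp only [Matrix.transpose_apply, clusterMatrix_apply, eq_comm]

theorem clusterMatrix_mul_apply (M : Matrix (Fin K × Fin m) (Fin K × Fin m) ℝ)
    (i j : Fin K × Fin m) : (clusterMatrix K m * M) i j = ∑ b, M (i.1, b) j := by
  rw [Matrix.mul_apply, ← sum_eq_sum_block i fun x => M x j]
  exact Finset.sum_congr rfl fun x _ => by rw [clusterMatrix_apply]; split_ifs <;> simp

theorem mul_clusterMatrix_apply (M : Matrix (Fin K × Fin m) (Fin K × Fin m) ℝ)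
    (i j : Fin K × Fin m) : (M * clusterMatrix K m) i j = ∑ b, M i (j.1, b) := by
  rw [Matrix.mul_apply, ← sum_eq_sum_block j fun x => M i x]
  exact Finset.sum_congr rfl fun x _ => by
    rw [clusterMatrix_apply]; simp only [eq_comm]; split_ifs <;> simp

theorem clusterMatrix_mul_self :
    clusterMatrix K m * clusterMatrix K m = (m : ℝ) • clusterMatrix K m := by
  ext i j
  rw [clusterMatrix_mul_apply, Matrix.smul_apply]
  simp only [clusterMatrix_apply]
  split_ifs <;> simp

theorem clusterMatrix_mem_feasible (hK : 0 < K) :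
    clusterMatrix K m ∈ sdp1Feasible (Fin K × Fin m) K := by
  have hK' : (K : ℝ) ≠ 0 := by positivity
  refine ⟨?_, ?_, ?_, ?_⟩
  · ext i
    simp only [Matrix.mulVec, dotProduct, mul_one]
    simp only [clusterMatrix_apply]
    rw [sum_eq_sum_block i fun _ => 1]
    simp [hK']
  · ext i
    simp [clusterMatrix_apply]
  · have h : clusterMatrix K m = Matrix.conjTranspose
        (Matrix.of fun (k : Fin K) (i : Fin K × Fin m) => if i.1 = k then (1 : ℝ) else 0) *
        (Matrix.of fun (k : Fin K) (i : Fin K × Fin m) => if i.1 = k then (1 : ℝ) else 0) := by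
      ext i j
      simp [clusterMatrix_apply, Matrix.mul_apply]
    rw [h]
    exact Matrix.posSemidef_conjTranspose_mul_self _
  · intro i j
    rw [clusterMatrix_apply]
    split_ifs <;> norm_num

/-- The mass that row `i` of `X` puts outside the community of `i`. -/
def rowLoss (X : Matrix (Fin K × Fin m) (Fin K × Fin m) ℝ) (i : Fin K × Fin m) : ℝ :=
  ∑ b, (1 - X i (i.1, b))

variable {X : Matrix (Fin K × Fin m) (Fin K × Fin m) ℝ}

theorem isSymm_of_feasible (hX : X ∈ sdp1Feasible (Fin K × Fin m) K) : X.IsSymm := by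
  have := hX.2.2.1.isHermitian
  rwa [Matrix.IsHermitian, Matrix.conjTranspose_eq_transpose_of_trivial] at this

theorem apply_self_of_feasible (hX : X ∈ sdp1Feasible (Fin K × Fin m) K) (i) : X i i = 1 :=
  congrFun hX.2.1 i

theorem apply_le_one_of_feasible (hX : X ∈ sdp1Feasible (Fin K × Fin m) K) (i j) : X i j ≤ 1 := by
  have h := hX.2.2.1.dotProduct_mulVec_nonneg (Pi.single i 1 - Pi.single j 1)
  have hs := (isSymm_of_feasible hX).apply i j
  simp only [star_trivial, Matrix.mulVec_sub, dotProduct_sub, sub_dotProduct,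
    Matrix.mulVec_single_one, single_dotProduct, Matrix.col_apply, one_mul,
    apply_self_of_feasible hX] at h
  linarith

theorem rowLoss_nonneg (hX : X ∈ sdp1Feasible (Fin K × Fin m) K) (i) : 0 ≤ rowLoss X i :=
  Finset.sum_nonneg fun b _ => by linarith [apply_le_one_of_feasible hX i (i.1, b)]

theorem sum_sub_eq_rowLoss (i : Fin K × Fin m) (c : ℝ) :
    ∑ j, (if i.1 = j.1 then c * (clusterMatrix K m i j - X i j) else 0) = c * rowLoss X i := by
  rw [sum_eq_sum_block i fun j => c * (clusterMatrix K m i j - X i j), rowLoss, Finset.mul_sum]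
  exact Finset.sum_congr rfl fun b _ => by simp [clusterMatrix_apply]

theorem sum_off_eq_rowLoss (hK : 0 < K) (hX : X ∈ sdp1Feasible (Fin K × Fin m) K)
    (i : Fin K × Fin m) : ∑ j, (if i.1 = j.1 then 0 else X i j) = rowLoss X i := by
  have hK' : (K : ℝ) ≠ 0 := by positivity
  have h1 : ∑ j, X i j = m := by
    have := congrFun hX.1 i
    simp only [Matrix.mulVec, dotProduct, mul_one] at this
    rw [this]
    simp [hK']
  have h3 : ∑ j, (if i.1 = j.1 then 0 else X i j) =
      ∑ j, X i j - ∑ j, (if i.1 = j.1 then X i j else 0) := by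
    rw [← Finset.sum_sub_distrib]
    exact Finset.sum_congr rfl fun j _ => by split_ifs <;> simp
  rw [h3, h1, sum_eq_sum_block i fun j => X i j, rowLoss]
  simp

theorem eq_clusterMatrix_of_rowLoss (hK : 0 < K) (hX : X ∈ sdp1Feasible (Fin K × Fin m) K)
    (h : ∀ i, rowLoss X i = 0) : X = clusterMatrix K m := by
  ext i j
  rw [clusterMatrix_apply]
  split_ifs with hij
  · have h1 := (Finset.sum_eq_zero_iff_of_nonneg fun b _ => by
      linarith [apply_le_one_of_feasible hX i (i.1, b)]).1 (h i) j.2 (Finset.mem_univ _)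
    rw [hij] at h1
    change 1 - X i j = 0 at h1
    linarith
  · have h1 := (Finset.sum_eq_zero_iff_of_nonneg fun j _ => by
      split_ifs
      · exact le_rfl
      · exact hX.2.2.2 i j).1 ((sum_off_eq_rowLoss hK hX i).trans (h i)) j (Finset.mem_univ _)
    rwa [if_neg hij] at h1

/-- The absolute values in row `i` of `clusterMatrix K m - X` sum to `2 * rowLoss X i`, half from
inside the community and half from outside. -/
theorem abs_trace_mul_le (hK : 0 < K) (hX : X ∈ sdp1Feasible (Fin K × Fin m) K)
    (M : Matrix (Fin K × Fin m) (Fin K × Fin m) ℝ) (R : Fin K × Fin m → ℝ)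
    (hM : ∀ i j, |M i j| ≤ R i) :
    |(M * (clusterMatrix K m - X)).trace| ≤ ∑ i, 2 * R i * rowLoss X i := by
  rw [trace_mul_eq_sum M (clusterMatrix_isSymm.sub (isSymm_of_feasible hX))]
  refine (Finset.abs_sum_le_sum_abs _ _).trans (Finset.sum_le_sum fun i _ => ?_)
  refine (Finset.abs_sum_le_sum_abs _ _).trans ?_
  calc ∑ j, |M i j * (clusterMatrix K m - X) i j|
      ≤ ∑ j, ((if i.1 = j.1 then R i * (clusterMatrix K m i j - X i j) else 0) +
          R i * (if i.1 = j.1 then 0 else X i j)) := by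
        refine Finset.sum_le_sum fun j _ => ?_
        rw [abs_mul, Matrix.sub_apply, clusterMatrix_apply]
        split_ifs
        · have h1 := apply_le_one_of_feasible hX i j
          rw [abs_of_nonneg (by linarith : 0 ≤ 1 - X i j)]
          have := mul_le_mul_of_nonneg_right (hM i j) (by linarith : 0 ≤ 1 - X i j)
          linarith
        · rw [zero_sub, abs_neg, abs_of_nonneg (hX.2.2.2 i j), zero_add]
          exact mul_le_mul_of_nonneg_right (hM i j) (hX.2.2.2 i j)
    _ = 2 * R i * rowLoss X i := by
        rw [Finset.sum_add_distrib, sum_sub_eq_rowLoss, ← Finset.mul_sum, sum_off_eq_rowLoss hK hX]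
        ring

theorem signal_le (hK : 0 < K) (hX : X ∈ sdp1Feasible (Fin K × Fin m) K)
    (Ψ : Matrix (Fin K) (Fin K) ℝ) (q : Fin K → ℝ) (hq : ∀ k l, l ≠ k → Ψ k l ≤ q k) :
    ∑ i, (Ψ i.1 i.1 - q i.1) * rowLoss X i ≤
      ((Matrix.of fun i j : Fin K × Fin m => Ψ i.1 j.1) * (clusterMatrix K m - X)).trace := by
  rw [trace_mul_eq_sum _ (clusterMatrix_isSymm.sub (isSymm_of_feasible hX))]
  refine Finset.sum_le_sum fun i _ => ?_
  calc (Ψ i.1 i.1 - q i.1) * rowLoss X i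
      = ∑ j, ((if i.1 = j.1 then Ψ i.1 i.1 * (clusterMatrix K m i j - X i j) else 0) -
          q i.1 * (if i.1 = j.1 then 0 else X i j)) := by
        rw [Finset.sum_sub_distrib, sum_sub_eq_rowLoss, ← Finset.mul_sum, sum_off_eq_rowLoss hK hX]
        ring
    _ ≤ _ := by
        refine Finset.sum_le_sum fun j _ => ?_
        rw [Matrix.of_apply, Matrix.sub_apply, clusterMatrix_apply]
        split_ifs with h
        · rw [h]; simp
        · have := mul_le_mul_of_nonneg_right (hq i.1 j.1 (Ne.symm h)) (hX.2.2.2 i j)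
          linarith

/-- The compression of `X` to the orthogonal complement of the community indicators. -/
def residual (X : Matrix (Fin K × Fin m) (Fin K × Fin m) ℝ) :
    Matrix (Fin K × Fin m) (Fin K × Fin m) ℝ :=
  (1 - (m : ℝ)⁻¹ • clusterMatrix K m) * X * (1 - (m : ℝ)⁻¹ • clusterMatrix K m)

theorem residual_posSemidef (hX : X ∈ sdp1Feasible (Fin K × Fin m) K) :
    (residual X).PosSemidef := by
  have h := hX.2.2.1.conjTranspose_mul_mul_same (1 - (m : ℝ)⁻¹ • clusterMatrix K m)
  rw [Matrix.conjTranspose_eq_transpose_of_trivial, Matrix.transpose_sub, Matrix.transpose_one,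
    Matrix.transpose_smul, clusterMatrix_isSymm.eq] at h
  exact h

/-- If `S` is the sum of the entries of the `k`-th diagonal block of `X`, the left side is `m - 2S/m
+ S/m = (m² - S)/m`. The factor `1/m` here is what makes an operator norm bound on the noise
affordable. -/
theorem sum_residual_diag (hm : 0 < m) (hX : X ∈ sdp1Feasible (Fin K × Fin m) K) (k : Fin K) :
    ∑ a, residual X (k, a) (k, a) = (m : ℝ)⁻¹ * ∑ a, rowLoss X (k, a) := by
  have hm' : (m : ℝ) ≠ 0 := by positivity
  set P := clusterMatrix K m with hP
  have hexp : residual X = X - (m : ℝ)⁻¹ • (P * X) - (m : ℝ)⁻¹ • (X * P) +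
      (m : ℝ)⁻¹ • (m : ℝ)⁻¹ • (P * X * P) := by
    rw [residual, ← hP, sub_mul, one_mul, mul_sub, mul_one, sub_mul, Matrix.smul_mul,
      Matrix.mul_smul, Matrix.smul_mul, Matrix.mul_smul]
    abel
  simp only [hexp, Matrix.add_apply, Matrix.sub_apply, Matrix.smul_apply, smul_eq_mul, hP,
    clusterMatrix_mul_apply, mul_clusterMatrix_apply, apply_self_of_feasible hX,
    Finset.sum_add_distrib, Finset.sum_sub_distrib, ← Finset.mul_sum, rowLoss]
  rw [Finset.sum_comm (f := fun a b => X (k, b) (k, a))]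
  simp
  field_simp
  ring

/-- The part of a matrix between different communities. -/
def offBlock (W : Matrix (Fin K × Fin m) (Fin K × Fin m) ℝ) :
    Matrix (Fin K × Fin m) (Fin K × Fin m) ℝ :=
  Matrix.of fun i j => if i.1 = j.1 then 0 else W i j

/-- The diagonal block of a matrix belonging to the community `k`. -/
def diagBlock (W : Matrix (Fin K × Fin m) (Fin K × Fin m) ℝ) (k : Fin K) :
    Matrix (Fin m) (Fin m) ℝ :=
  W.submatrix (fun a => (k, a)) (fun a => (k, a))

theorem trace_mul_eq_blocks (W Y : Matrix (Fin K × Fin m) (Fin K × Fin m) ℝ) :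
    (W * Y).trace = ∑ k, (diagBlock W k * diagBlock Y k).trace + (offBlock W * Y).trace := by
  simp only [Matrix.trace, Matrix.diag_apply, Matrix.mul_apply, diagBlock, offBlock,
    Matrix.submatrix_apply, Matrix.of_apply]
  rw [Fintype.sum_prod_type, Fintype.sum_prod_type, ← Finset.sum_add_distrib]
  refine Finset.sum_congr rfl fun k _ => ?_
  rw [← Finset.sum_add_distrib]
  refine Finset.sum_congr rfl fun a _ => ?_
  rw [← sum_eq_sum_block (k, a) fun j => W (k, a) j * Y j (k, a), ← Finset.sum_add_distrib]
  exact Finset.sum_congr rfl fun j _ => by split_ifs <;> simp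

/-- Splitting off the diagonal blocks keeps the cost local: community `k` pays for its own block
norm `β k`, not for that of a denser community, and only `γ` is shared. -/
theorem trace_mul_residual_le (hm : 0 < m) (hX : X ∈ sdp1Feasible (Fin K × Fin m) K)
    (W : Matrix (Fin K × Fin m) (Fin K × Fin m) ℝ) (β : Fin K → ℝ) (γ : ℝ)
    (hβ : ∀ k, ‖Matrix.toEuclideanCLM (𝕜 := ℝ) (diagBlock W k)‖ ≤ β k)
    (hγ : ‖Matrix.toEuclideanCLM (𝕜 := ℝ) (offBlock W)‖ ≤ γ) :
    (W * residual X).trace ≤ ∑ i, (β i.1 + γ) / m * rowLoss X i := by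
  have hY := residual_posSemidef hX
  have hT : ∀ k, (diagBlock (residual X) k).trace = (m : ℝ)⁻¹ * ∑ a, rowLoss X (k, a) :=
    fun k => sum_residual_diag hm hX k
  have hT' : (residual X).trace = ∑ k, (m : ℝ)⁻¹ * ∑ a, rowLoss X (k, a) := by
    rw [Matrix.trace, Fintype.sum_prod_type]
    exact Finset.sum_congr rfl fun k _ => sum_residual_diag hm hX k
  have hnn : ∀ k, 0 ≤ (m : ℝ)⁻¹ * ∑ a, rowLoss X (k, a) := fun k =>
    mul_nonneg (by positivity) (Finset.sum_nonneg fun a _ => rowLoss_nonneg hX _)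
  rw [trace_mul_eq_blocks]
  calc ∑ k, (diagBlock W k * diagBlock (residual X) k).trace + (offBlock W * residual X).trace
      ≤ ∑ k, β k * ((m : ℝ)⁻¹ * ∑ a, rowLoss X (k, a)) +
          γ * ∑ k, (m : ℝ)⁻¹ * ∑ a, rowLoss X (k, a) := by
        refine add_le_add (Finset.sum_le_sum fun k _ => ?_) ?_
        · refine (trace_mul_le_norm_mul_trace _ (hY.submatrix _)).trans ?_
          change _ * (diagBlock (residual X) k).trace ≤ _
          rw [hT]
          exact mul_le_mul_of_nonneg_right (hβ k) (hnn k)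
        · refine (trace_mul_le_norm_mul_trace _ hY).trans ?_
          rw [hT']
          exact mul_le_mul_of_nonneg_right hγ (Finset.sum_nonneg fun k _ => hnn k)
    _ = ∑ i, (β i.1 + γ) / m * rowLoss X i := by
        rw [Fintype.sum_prod_type, Finset.mul_sum, ← Finset.sum_add_distrib]
        refine Finset.sum_congr rfl fun k _ => ?_
        change _ = ∑ a, (β k + γ) / m * rowLoss X (k, a)
        rw [← Finset.mul_sum]
        ring

theorem trace_mul_sub_eq (hm : 0 < m) (W : Matrix (Fin K × Fin m) (Fin K × Fin m) ℝ) :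
    (W * (clusterMatrix K m - X)).trace =
      (((m : ℝ)⁻¹ • (W * clusterMatrix K m)) * (clusterMatrix K m - X)).trace +
      (((m : ℝ)⁻¹ • (clusterMatrix K m * W)) * (clusterMatrix K m - X)).trace -
      (((m : ℝ)⁻¹ • (m : ℝ)⁻¹ • (clusterMatrix K m * W * clusterMatrix K m)) *
        (clusterMatrix K m - X)).trace - (W * residual X).trace := by
  have hm' : (m : ℝ) ≠ 0 := by positivity
  set Z := clusterMatrix K m with hZ
  set P := (m : ℝ)⁻¹ • Z with hP
  have hPZ : P * Z = Z := by
    rw [hP, Matrix.smul_mul, hZ, clusterMatrix_mul_self, smul_smul, inv_mul_cancel₀ hm', one_smul]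
  have hZP : Z * P = Z := by
    rw [hP, Matrix.mul_smul, hZ, clusterMatrix_mul_self, smul_smul, inv_mul_cancel₀ hm', one_smul]
  have h1 : (m : ℝ)⁻¹ • (W * Z) = W * P := by rw [hP, Matrix.mul_smul]
  have h2 : (m : ℝ)⁻¹ • (Z * W) = P * W := by rw [hP, Matrix.smul_mul]
  have h3 : (m : ℝ)⁻¹ • (m : ℝ)⁻¹ • (Z * W * Z) = P * W * P := by
    rw [hP, Matrix.smul_mul, Matrix.smul_mul, Matrix.mul_smul]
  have hD : Z - X = P * (Z - X) + (Z - X) * P - P * (Z - X) * P - residual X := by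
    have : residual X = (1 - P) * X * (1 - P) := rfl
    rw [this]
    have e : P * (Z - X) + (Z - X) * P - P * (Z - X) * P - (1 - P) * X * (1 - P) =
        P * Z + Z * P - P * Z * P - X := by noncomm_ring
    rw [e, hPZ, hZP]
    abel
  rw [h1, h2, h3]
  conv_lhs => rw [hD]
  rw [mul_sub, mul_sub, mul_add, Matrix.trace_sub, Matrix.trace_sub, Matrix.trace_add]
  congr 1
  congr 1
  · congr 1
    · rw [mul_assoc]
    · rw [← mul_assoc, Matrix.trace_mul_comm, mul_assoc]
  · rw [← mul_assoc, Matrix.trace_mul_comm, mul_assoc P, mul_assoc P, mul_assoc W]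

/-- If the noise `W` is small compared with the gaps between the within-community and the
cross-community probabilities, the cluster matrix is the unique solution. -/
theorem sdp1_eq_singleton (hK : 0 < K) (hm : 0 < m)
    {A W : Matrix (Fin K × Fin m) (Fin K × Fin m) ℝ} (hW : W.IsSymm)
    {Ψ : Matrix (Fin K) (Fin K) ℝ} (hA : ∀ i j, i ≠ j → A i j = Ψ i.1 j.1 + W i j)
    (q R β : Fin K → ℝ) (γ : ℝ) (hq : ∀ k l, l ≠ k → Ψ k l ≤ q k)
    (hR : ∀ i l, |∑ b, W i (l, b)| ≤ R i.1)
    (hβ : ∀ k, ‖Matrix.toEuclideanCLM (𝕜 := ℝ) (diagBlock W k)‖ ≤ β k)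
    (hγ : ‖Matrix.toEuclideanCLM (𝕜 := ℝ) (offBlock W)‖ ≤ γ)
    (hgap : ∀ k, 6 * R k + β k + γ < m * (Ψ k k - q k)) :
    sdp1 K A = {clusterMatrix K m} := by
  have hm' : (0 : ℝ) < m := by exact_mod_cast hm
  set Z := clusterMatrix K m with hZ
  have hWP : ∀ i j, |((m : ℝ)⁻¹ • (W * Z)) i j| ≤ R i.1 / m := by
    intro i j
    rw [Matrix.smul_apply, hZ, mul_clusterMatrix_apply, smul_eq_mul, abs_mul,
      abs_of_pos (inv_pos.2 hm'), div_eq_inv_mul]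
    exact mul_le_mul_of_nonneg_left (hR _ _) (by positivity)
  have hPWP : ∀ i j, |((m : ℝ)⁻¹ • (m : ℝ)⁻¹ • (Z * W * Z)) i j| ≤ R i.1 / m := by
    intro i j
    have h1 : (m : ℝ)⁻¹ • (m : ℝ)⁻¹ • (Z * W * Z) =
        (m : ℝ)⁻¹ • (Z * ((m : ℝ)⁻¹ • (W * Z))) := by rw [Matrix.mul_smul, mul_assoc]
    rw [h1, Matrix.smul_apply, hZ, clusterMatrix_mul_apply, smul_eq_mul, abs_mul,
      abs_of_pos (inv_pos.2 hm')]
    calc (m : ℝ)⁻¹ * |∑ b, ((m : ℝ)⁻¹ • (W * Z)) (i.1, b) j|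
        ≤ (m : ℝ)⁻¹ * ∑ _b : Fin m, R i.1 / m := by
          refine mul_le_mul_of_nonneg_left ?_ (by positivity)
          exact (Finset.abs_sum_le_sum_abs _ _).trans
            (Finset.sum_le_sum fun b _ => hWP (i.1, b) j)
      _ = R i.1 / m := by
          rw [Finset.sum_const, Finset.card_univ, Fintype.card_fin, nsmul_eq_mul]
          field_simp
  have key : ∀ X ∈ sdp1Feasible (Fin K × Fin m) K,
      ∑ i, ((Ψ i.1 i.1 - q i.1) - (6 * R i.1 + β i.1 + γ) / m) * rowLoss X i ≤
        (A * Z).trace - (A * X).trace := by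
    intro X hX
    have hDs : (Z - X).IsSymm := clusterMatrix_isSymm.sub (isSymm_of_feasible hX)
    have h1 : (A * Z).trace - (A * X).trace =
        ((Matrix.of fun i j : Fin K × Fin m => Ψ i.1 j.1) * (Z - X)).trace +
          (W * (Z - X)).trace := by
      rw [← Matrix.trace_sub, ← mul_sub, trace_mul_eq_sum _ hDs, trace_mul_eq_sum _ hDs,
        trace_mul_eq_sum _ hDs, ← Finset.sum_add_distrib]
      refine Finset.sum_congr rfl fun i _ => ?_
      rw [← Finset.sum_add_distrib]
      refine Finset.sum_congr rfl fun j _ => ?_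
      -- `Z - X` vanishes on the diagonal, so the arbitrary diagonal of `A` plays no role.
      rcases eq_or_ne i j with rfl | hij
      · rw [Matrix.sub_apply, apply_self_of_feasible hX, hZ, clusterMatrix_apply]
        simp
      · rw [hA i j hij, Matrix.of_apply]
        ring
    have h2 := signal_le hK hX Ψ q hq
    have h3 := trace_mul_sub_eq (X := X) hm W
    have h4 := abs_le.1 (abs_trace_mul_le hK hX _ (fun i => R i.1 / m) hWP)
    have h5 : (((m : ℝ)⁻¹ • (Z * W)) * (Z - X)).trace =
        (((m : ℝ)⁻¹ • (W * Z)) * (Z - X)).trace := by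
      rw [← Matrix.trace_transpose, Matrix.transpose_mul, hDs.eq, Matrix.transpose_smul,
        Matrix.transpose_mul, hW.eq, hZ, clusterMatrix_isSymm.eq, Matrix.trace_mul_comm]
    have h6 := abs_le.1 (abs_trace_mul_le hK hX _ (fun i => R i.1 / m) hPWP)
    have h7 := trace_mul_residual_le hm hX W β γ hβ hγ
    -- The coefficient `6` is three averaged terms, each costing `2 * R / m` per unit of row loss.
    have h8 : ∑ i, ((Ψ i.1 i.1 - q i.1) - (6 * R i.1 + β i.1 + γ) / m) * rowLoss X i =
        ∑ i, (Ψ i.1 i.1 - q i.1) * rowLoss X i - 3 * ∑ i, 2 * (R i.1 / m) * rowLoss X i -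
          ∑ i, (β i.1 + γ) / m * rowLoss X i := by
      rw [Finset.mul_sum, ← Finset.sum_sub_distrib, ← Finset.sum_sub_distrib]
      exact Finset.sum_congr rfl fun i _ => by ring
    rw [← hZ] at h2 h3 h4 h6
    rw [h5] at h3
    rw [h8, h1]
    linarith [h4.1, h6.2]
  have hpos : ∀ i : Fin K × Fin m, 0 < (Ψ i.1 i.1 - q i.1) - (6 * R i.1 + β i.1 + γ) / m := by
    intro i
    rw [sub_pos, div_lt_iff₀' hm']
    exact hgap i.1
  have hnn : ∀ X ∈ sdp1Feasible (Fin K × Fin m) K, ∀ i ∈ Finset.univ,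
      0 ≤ ((Ψ i.1 i.1 - q i.1) - (6 * R i.1 + β i.1 + γ) / m) * rowLoss X i :=
    fun X hX i _ => mul_nonneg (hpos i).le (rowLoss_nonneg hX i)
  ext X
  rw [Set.mem_singleton_iff]
  constructor
  · rintro ⟨hX, hmax⟩
    have h1 := hmax Z (clusterMatrix_mem_feasible hK)
    have h2 := key X hX
    have h3 : ∑ i, ((Ψ i.1 i.1 - q i.1) - (6 * R i.1 + β i.1 + γ) / m) * rowLoss X i = 0 :=
      le_antisymm (by linarith) (Finset.sum_nonneg (hnn X hX))
    refine eq_clusterMatrix_of_rowLoss hK hX fun i => ?_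
    have h4 := (Finset.sum_eq_zero_iff_of_nonneg (hnn X hX)).1 h3 i (Finset.mem_univ _)
    exact (mul_eq_zero.1 h4).resolve_left (hpos i).ne'
  · rintro rfl
    refine ⟨clusterMatrix_mem_feasible hK, fun Y hY => ?_⟩
    have := (Finset.sum_nonneg (hnn Y hY)).trans (key Y hY)
    linarith

end Deterministic

/-! ### The adjacency concentration property -/

theorem adjacencyConcentration : AdjacencyConcentration.{u} (30 + 4 * noiseConst) 1 4 1 := by
  intro n hn Ω _ μ _ A σ hmeas hsymm hbin hdiag hind hσ hvar hlog
  have hN : 0 ≤ noiseConst := Real.sqrt_nonneg _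
  have hn' : (0 : ℝ) < n := by exact_mod_cast hn
  have hInt : ∀ i j, Integrable (fun ω => A ω i j) μ := fun i j =>
    Integrable.of_bound (C := 1) (hmeas i j).aestronglyMeasurable
      (Filter.Eventually.of_forall fun ω => by rcases hbin ω i j with h | h <;> simp [h])
  have h0 : ∀ i j, 0 ≤ ∫ ω, A ω i j ∂μ := fun i j =>
    integral_nonneg fun ω => by rcases hbin ω i j with h | h <;> simp [h]
  have h1 : ∀ i j, ∫ ω, A ω i j ∂μ ≤ 1 := fun i j => by
    have := integral_mono (hInt i j) (integrable_const (μ := μ) (1 : ℝ))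
      (fun ω => by rcases hbin ω i j with h | h <;> simp [h])
    simpa using this
  have hsymm' : ∀ ω i j, A ω i j = A ω j i := fun ω i j => ((hsymm ω).apply i j).symm
  -- Truncation at one meets the requirement `τ ≤ 1` of the moment bound; `log n ≤ n` keeps the
  -- degree condition.
  set τ : ℝ := min (σ ^ 2) 1 with hτ
  have hτ0 : 0 ≤ τ := le_min (sq_nonneg _) zero_le_one
  have hW : IsCenteredNoise μ (OrderDual.toDual : Fin n → (Fin n)ᵒᵈ) τ
      (fun ω => A ω - Matrix.of fun i j => ∫ ω', A ω' i j ∂μ) := by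
    have habs : ∀ ω i j, |A ω i j - ∫ ω', A ω' i j ∂μ| ≤ 1 := fun ω i j => by
      rw [abs_le]
      have := h0 i j
      have := h1 i j
      rcases hbin ω i j with h | h <;> rw [h] <;> constructor <;> linarith
    refine ⟨fun i j => (hmeas i j).sub_const _, fun ω => ?_, fun ω i => ?_, habs, fun i j => ?_,
      fun i j => ?_, ?_⟩
    · ext i j
      simp only [Matrix.transpose_apply, Matrix.sub_apply, Matrix.of_apply, hsymm' _ i j]
    · simp [hdiag]
    · simp only [Matrix.sub_apply, Matrix.of_apply]
      rw [integral_sub (hInt i j) (integrable_const _)]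
      simp
    · simp only [Matrix.sub_apply, Matrix.of_apply]
      refine le_min ?_ ?_
      · rw [← variance_eq_integral (hmeas i j).aemeasurable]
        exact hvar i j
      · have hle : ∀ ω, (A ω i j - ∫ ω', A ω' i j ∂μ) ^ 2 ≤ 1 := fun ω => by
          rw [sq_le_one_iff_abs_le_one]
          exact habs ω i j
        have := integral_mono (μ := μ) (Integrable.of_bound (C := 1)
          (((hmeas i j).sub_const _).pow_const 2).aestronglyMeasurable
          (Filter.Eventually.of_forall fun ω => by
            rw [Real.norm_eq_abs, abs_of_nonneg (sq_nonneg _)]; exact hle ω))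
          (integrable_const (1 : ℝ)) hle
        simpa using this
    · exact hind.comp (fun e x => x - ∫ ω', A ω' e.1.1 e.1.2 ∂μ)
        fun e => measurable_id.sub_const _
  have hlogn : Real.log n ≤ n * τ := by
    rw [hτ, mul_min_of_nonneg _ _ hn'.le]
    refine le_min (by linarith) ?_
    rw [mul_one]
    exact (Real.log_le_sub_one_of_pos hn').trans (by linarith)
  have hmain := hW.measureReal_lt_norm_le OrderDual.toDual.injective hτ0 (min_le_right _ _) hn
    (Fintype.card_fin n) hlogn
  set bad := {ω | noiseConst * √(n * τ) < ‖Matrix.toEuclideanCLM (𝕜 := ℝ)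
    (A ω - Matrix.of fun i j => ∫ ω', A ω' i j ∂μ)‖} with hbad
  set good := {ω | ‖Matrix.toEuclideanCLM (𝕜 := ℝ)
    (A ω - Matrix.of fun i j => ∫ ω', A ω' i j ∂μ)‖ ≤ (30 + 4 * noiseConst) * σ * √(n : ℝ)}
    with hgood
  have hcover : (Set.univ : Set Ω) ⊆ good ∪ bad := by
    intro ω _
    by_cases hω : ω ∈ bad
    · exact Or.inr hω
    · left
      rw [hbad, Set.mem_ofPred_eq, not_lt] at hω
      rw [hgood, Set.mem_ofPred_eq]
      refine hω.trans ?_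
      have h2 : √(n * τ) ≤ σ * √(n : ℝ) := by
        rw [← Real.sqrt_sq hσ, ← Real.sqrt_mul (sq_nonneg _), mul_comm]
        refine Real.sqrt_le_sqrt ?_
        exact mul_le_mul_of_nonneg_right (min_le_left _ _) hn'.le
      rw [mul_assoc]
      refine mul_le_mul (by linarith) h2 (Real.sqrt_nonneg _) (by linarith)
  have h3 := (measureReal_mono (μ := μ) hcover).trans (measureReal_union_le good bad)
  rw [probReal_univ] at h3
  rw [Real.rpow_neg_one]
  have : (0 : ℝ) < (n : ℝ)⁻¹ := by positivity
  linarith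

/-! ### Deviations of sums of bounded centered variables -/

theorem mgf_le_exp_of_abs_le_one {Ω : Type*} [MeasurableSpace Ω] {μ : Measure Ω}
    [IsProbabilityMeasure μ] {X : Ω → ℝ} (hm : Measurable X) (hb : ∀ ω, |X ω| ≤ 1)
    (h0 : ∫ ω, X ω ∂μ = 0) {v : ℝ} (hv : ∫ ω, X ω ^ 2 ∂μ ≤ v) {t : ℝ} (ht : |t| ≤ 1) :
    mgf X μ t ≤ Real.exp (t ^ 2 * v) := by
  have hX : Integrable X μ := Integrable.of_bound (C := 1) hm.aestronglyMeasurable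
    (Filter.Eventually.of_forall hb)
  have hX2 : Integrable (fun ω => X ω ^ 2) μ :=
    Integrable.of_bound (C := 1) (hm.pow_const 2).aestronglyMeasurable
      (Filter.Eventually.of_forall fun ω => by
        rw [Real.norm_eq_abs, abs_pow]
        exact pow_le_one₀ (abs_nonneg _) (hb ω))
  have htX : ∀ ω, |t * X ω| ≤ 1 := fun ω => by
    rw [abs_mul]
    exact mul_le_one₀ ht (abs_nonneg _) (hb ω)
  have hexp : Integrable (fun ω => Real.exp (t * X ω)) μ :=
    Integrable.of_bound (C := Real.exp 1) ((hm.const_mul t).exp).aestronglyMeasurable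
      (Filter.Eventually.of_forall fun ω => by
        rw [Real.norm_eq_abs, Real.abs_exp]
        exact Real.exp_le_exp.2 ((le_abs_self _).trans (htX ω)))
  calc mgf X μ t = ∫ ω, Real.exp (t * X ω) ∂μ := rfl
    _ ≤ ∫ ω, (1 + t * X ω + t ^ 2 * X ω ^ 2) ∂μ := by
        refine integral_mono hexp
          (((integrable_const _).add (hX.const_mul t)).add (hX2.const_mul (t ^ 2))) fun ω => ?_
        have := (abs_le.1 (Real.abs_exp_sub_one_sub_id_le (htX ω))).2
        rw [mul_pow] at this
        change Real.exp (t * X ω) ≤ 1 + t * X ω + t ^ 2 * X ω ^ 2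
        linarith
    _ = 1 + t ^ 2 * ∫ ω, X ω ^ 2 ∂μ := by
        have h1 : Integrable (fun ω => 1 + t * X ω) μ := (integrable_const _).add (hX.const_mul t)
        rw [integral_add h1 (hX2.const_mul (t ^ 2)), integral_add (integrable_const _)
          (hX.const_mul t), integral_const_mul, integral_const_mul, h0]
        simp
    _ ≤ 1 + t ^ 2 * v := by gcongr
    _ ≤ _ := by linarith [Real.add_one_le_exp (t ^ 2 * v)]

theorem measureReal_abs_sum_ge_le {Ω ι : Type*} [MeasurableSpace Ω] {μ : Measure Ω}
    [IsProbabilityMeasure μ] {X : ι → Ω → ℝ} (hind : iIndepFun X μ) (hm : ∀ i, Measurable (X i))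
    (hb : ∀ i ω, |X i ω| ≤ 1) (h0 : ∀ i, ∫ ω, X i ω ∂μ = 0) (s : Finset ι) {v M l : ℝ}
    (hv : ∀ i ∈ s, ∫ ω, X i ω ^ 2 ∂μ ≤ v) (hl : 0 < l) (hlM : l ≤ M) (hsM : s.card * v ≤ M) :
    μ.real {ω | 5 * √(M * l) ≤ |∑ i ∈ s, X i ω|} ≤ 2 * Real.exp (-(4 * l)) := by
  have hM : 0 < M := hl.trans_le hlM
  have hmgf : ∀ t, |t| ≤ 1 → mgf (∑ i ∈ s, X i) μ t ≤ Real.exp (t ^ 2 * M) := by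
    intro t ht
    rw [hind.mgf_sum hm s]
    calc ∏ i ∈ s, mgf (X i) μ t ≤ ∏ _i ∈ s, Real.exp (t ^ 2 * v) :=
          Finset.prod_le_prod (fun i _ => mgf_nonneg) fun i hi =>
            mgf_le_exp_of_abs_le_one (hm i) (hb i) (h0 i) (hv i hi) ht
      _ = Real.exp (t ^ 2 * (s.card * v)) := by
          rw [Finset.prod_const, ← Real.exp_nat_mul]
          congr 1
          ring
      _ ≤ _ := Real.exp_le_exp.2 (by gcongr)
  have hmS : Measurable (∑ i ∈ s, X i) := by
    rw [show ∑ i ∈ s, X i = fun ω => ∑ i ∈ s, X i ω from funext fun ω => Finset.sum_apply _ _ _]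
    exact Finset.measurable_sum _ fun i _ => hm i
  have hbS : ∀ ω, |(∑ i ∈ s, X i) ω| ≤ s.card := fun ω => by
    rw [Finset.sum_apply]
    refine (Finset.abs_sum_le_sum_abs _ _).trans ?_
    refine (Finset.sum_le_sum fun i _ => hb i ω).trans ?_
    simp
  have hInt : ∀ t : ℝ, Integrable (fun ω => Real.exp (t * (∑ i ∈ s, X i) ω)) μ := fun t =>
    Integrable.of_bound (C := Real.exp (|t| * s.card)) ((hmS.const_mul t).exp).aestronglyMeasurable
      (Filter.Eventually.of_forall fun ω => by
        rw [Real.norm_eq_abs, Real.abs_exp]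
        refine Real.exp_le_exp.2 ((le_abs_self _).trans ?_)
        rw [abs_mul]
        exact mul_le_mul_of_nonneg_left (hbS ω) (abs_nonneg _))
  -- With this `t` the Chernoff exponent is `-5l + l = -4l`, and `l ≤ M` ensures `t ≤ 1`, as the
  -- quadratic bound on the moment generating function requires.
  set t := √(l / M) with ht
  have ht0 : 0 ≤ t := Real.sqrt_nonneg _
  have ht1 : |t| ≤ 1 := by
    rw [abs_of_nonneg ht0, ht, Real.sqrt_le_one, div_le_one hM]
    exact hlM
  have ht2 : t ^ 2 * M = l := by
    rw [ht, Real.sq_sqrt (by positivity)]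
    field_simp
  have ht3 : t * √(M * l) = l := by
    rw [ht, ← Real.sqrt_mul (by positivity)]
    have : l / M * (M * l) = l ^ 2 := by field_simp
    rw [this, Real.sqrt_sq hl.le]
  have hup := measure_ge_le_exp_mul_mgf (μ := μ) (X := ∑ i ∈ s, X i) (5 * √(M * l)) ht0 (hInt t)
  have hlo := measure_le_le_exp_mul_mgf (μ := μ) (X := ∑ i ∈ s, X i) (-(5 * √(M * l)))
    (neg_nonpos.2 ht0) (hInt (-t))
  have hval : Real.exp (-t * (5 * √(M * l))) * Real.exp (t ^ 2 * M) = Real.exp (-(4 * l)) := by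
    rw [← Real.exp_add, ht2]
    congr 1
    linear_combination (-5) * ht3
  have hup' : μ.real {ω | 5 * √(M * l) ≤ (∑ i ∈ s, X i) ω} ≤ Real.exp (-(4 * l)) := by
    rw [← hval]
    exact hup.trans (mul_le_mul_of_nonneg_left (hmgf t ht1) (Real.exp_pos _).le)
  have hlo' : μ.real {ω | (∑ i ∈ s, X i) ω ≤ -(5 * √(M * l))} ≤ Real.exp (-(4 * l)) := by
    rw [← hval]
    refine hlo.trans ?_
    have h1 := hmgf (-t) (by rwa [abs_neg])
    rw [neg_sq] at h1
    rw [neg_neg, mul_neg, ← neg_mul]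
    exact mul_le_mul_of_nonneg_left h1 (Real.exp_pos _).le
  have hsub : {ω | 5 * √(M * l) ≤ |∑ i ∈ s, X i ω|} ⊆
      {ω | 5 * √(M * l) ≤ (∑ i ∈ s, X i) ω} ∪ {ω | (∑ i ∈ s, X i) ω ≤ -(5 * √(M * l))} := by
    intro ω hω
    simp only [Set.mem_ofPred_eq, Set.mem_union, Finset.sum_apply] at hω ⊢
    rcases le_abs.1 hω with h | h
    · exact Or.inl h
    · exact Or.inr (by linarith)
  have := (measureReal_mono (μ := μ) hsub).trans (measureReal_union_le _ _)
  linarith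

/-! ### The noise of the balanced block model -/

/-- The centered adjacency matrix, with zero diagonal. -/
def blockNoise {K m : ℕ} (Ψ : Matrix (Fin K) (Fin K) ℝ)
    (A : Matrix (Fin K × Fin m) (Fin K × Fin m) ℝ) : Matrix (Fin K × Fin m) (Fin K × Fin m) ℝ :=
  Matrix.of fun i j => if i = j then 0 else A i j - Ψ i.1 j.1

section BlockNoise

variable {Ω : Type*} [MeasurableSpace Ω] {μ : Measure Ω} {K m : ℕ}
  {Ψ : Matrix (Fin K) (Fin K) ℝ} {A : Ω → Matrix (Fin K × Fin m) (Fin K × Fin m) ℝ}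

theorem integral_adjacency (hΨ : IsEdgeProbMatrix Ψ) (hA : IsBalancedBlockModel μ m Ψ A)
    {i j : Fin K × Fin m} (hij : i ≠ j) : ∫ ω, A ω i j ∂μ = Ψ i.1 j.1 := by
  have hset : MeasurableSet {ω | A ω i j = 1} := hA.measurable i j hij (measurableSet_singleton 1)
  have h : (fun ω => A ω i j) = Set.indicator {ω | A ω i j = 1} 1 := by
    ext ω
    by_cases h1 : A ω i j = 1
    · rw [Set.indicator_of_mem (show ω ∈ {ω | A ω i j = 1} from h1), h1]; rfl
    · rw [Set.indicator_of_notMem (show ω ∉ {ω | A ω i j = 1} from h1)]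
      exact (hA.binary ω i j hij).resolve_right h1
  rw [h, integral_indicator_one hset, measureReal_def, hA.prob i j hij,
    ENNReal.toReal_ofReal (hΨ.mem_Icc _ _).1]

variable [IsProbabilityMeasure μ]

theorem integrable_adjacency (hA : IsBalancedBlockModel μ m Ψ A)
    {i j : Fin K × Fin m} (hij : i ≠ j) : Integrable (fun ω => A ω i j) μ :=
  Integrable.of_bound (C := 1) (hA.measurable i j hij).aestronglyMeasurable
    (Filter.Eventually.of_forall fun ω => by rcases hA.binary ω i j hij with h | h <;> simp [h])

theorem integral_blockNoise_sq_le (hΨ : IsEdgeProbMatrix Ψ) (hA : IsBalancedBlockModel μ m Ψ A)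
    (i j : Fin K × Fin m) : ∫ ω, blockNoise Ψ (A ω) i j ^ 2 ∂μ ≤ Ψ i.1 j.1 := by
  obtain ⟨h0, h1⟩ := hΨ.mem_Icc i.1 j.1
  rcases eq_or_ne i j with rfl | hij
  · simpa [blockNoise] using h0
  · have h : ∀ ω, blockNoise Ψ (A ω) i j ^ 2 =
        (1 - 2 * Ψ i.1 j.1) * A ω i j + Ψ i.1 j.1 ^ 2 := by
      intro ω
      rw [blockNoise, Matrix.of_apply, if_neg hij]
      rcases hA.binary ω i j hij with h | h <;> rw [h] <;> ring
    simp_rw [h]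
    rw [integral_add ((integrable_adjacency hA hij).const_mul _) (integrable_const _),
      integral_const_mul, integral_adjacency hΨ hA hij]
    simp
    nlinarith

theorem blockNoise_isCenteredNoise (hΨ : IsEdgeProbMatrix Ψ)
    (hA : IsBalancedBlockModel μ m Ψ A) :
    IsCenteredNoise μ (toLex : Fin K × Fin m → Fin K ×ₗ Fin m) 1 fun ω => blockNoise Ψ (A ω) := by
  refine ⟨fun i j => ?_, fun ω => ?_, fun ω i => by simp [blockNoise], fun ω i j => ?_,
    fun i j => ?_, fun i j => (integral_blockNoise_sq_le hΨ hA i j).trans (hΨ.mem_Icc _ _).2, ?_⟩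
  · rcases eq_or_ne i j with rfl | hij
    · simp [blockNoise]
    · simp only [blockNoise, Matrix.of_apply, if_neg hij]
      exact (hA.measurable i j hij).sub_const _
  · ext i j
    simp only [Matrix.transpose_apply, blockNoise, Matrix.of_apply, eq_comm (a := j),
      (hA.symm ω).apply i j, hΨ.symm.apply i.1 j.1]
  · obtain ⟨h0, h1⟩ := hΨ.mem_Icc i.1 j.1
    rcases eq_or_ne i j with rfl | hij
    · simp [blockNoise]
    · rw [blockNoise, Matrix.of_apply, if_neg hij, abs_le]
      rcases hA.binary ω i j hij with h | h <;> rw [h] <;> constructor <;> linarith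
  · rcases eq_or_ne i j with rfl | hij
    · simp [blockNoise]
    · simp only [blockNoise, Matrix.of_apply, if_neg hij]
      rw [integral_sub (integrable_adjacency hA hij) (integrable_const _),
        integral_adjacency hΨ hA hij]
      simp
  · have h := hA.indep.comp (fun e x => x - Ψ e.1.1.1 e.1.2.1) fun e => measurable_id.sub_const _
    convert! h using 2 with e
    funext ω
    have hne : e.1.1 ≠ e.1.2 := fun h => e.2.ne (congrArg toLex h)
    simp [blockNoise, if_neg hne]

theorem diagBlock_isCenteredNoise (hΨ : IsEdgeProbMatrix Ψ) (hA : IsBalancedBlockModel μ m Ψ A)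
    (k : Fin K) :
    IsCenteredNoise μ (id : Fin m → Fin m) (Ψ k k)
      fun ω => diagBlock (blockNoise Ψ (A ω)) k := by
  have hW := blockNoise_isCenteredNoise hΨ hA
  refine ⟨fun a b => hW.measurable _ _, fun ω => (hW.symm ω).submatrix _, fun ω a => hW.diag ω _,
    fun ω a b => hW.abs_le_one ω _ _, fun a b => hW.integral_eq_zero _ _,
    fun a b => integral_blockNoise_sq_le hΨ hA (k, a) (k, b), ?_⟩
  let g : {e : Fin m × Fin m // id e.1 < id e.2} →
      {e : (Fin K × Fin m) × (Fin K × Fin m) // toLex e.1 < toLex e.2} :=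
    fun e => ⟨((k, e.1.1), (k, e.1.2)), Prod.Lex.toLex_lt_toLex.2 (Or.inr ⟨rfl, e.2⟩)⟩
  have hg : Function.Injective g := by
    rintro ⟨⟨a, b⟩, h⟩ ⟨⟨a', b'⟩, h'⟩ heq
    simp only [g, Subtype.mk.injEq, Prod.mk.injEq, true_and] at heq
    simp [heq]
  exact hW.indep.precomp hg

theorem offBlock_isCenteredNoise (hΨ : IsEdgeProbMatrix Ψ) (hA : IsBalancedBlockModel μ m Ψ A)
    {τ : ℝ} (hτ0 : 0 ≤ τ) (hτ : ∀ k l, l ≠ k → Ψ k l ≤ τ) :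
    IsCenteredNoise μ (toLex : Fin K × Fin m → Fin K ×ₗ Fin m) τ
      fun ω => offBlock (blockNoise Ψ (A ω)) := by
  have hW := blockNoise_isCenteredNoise hΨ hA
  refine ⟨fun i j => ?_, fun ω => ?_, fun ω i => by simp [offBlock], fun ω i j => ?_,
    fun i j => ?_, fun i j => ?_, ?_⟩
  · by_cases h : i.1 = j.1
    · simp [offBlock, h]
    · simpa [offBlock, h] using hW.measurable i j
  · ext i j
    simp only [Matrix.transpose_apply, offBlock, Matrix.of_apply, eq_comm (a := j.1),
      (hW.symm ω).apply i j]
  · by_cases h : i.1 = j.1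
    · simp [offBlock, h]
    · simpa [offBlock, h] using hW.abs_le_one ω i j
  · by_cases h : i.1 = j.1
    · simp [offBlock, h]
    · simpa [offBlock, h] using hW.integral_eq_zero i j
  · by_cases h : i.1 = j.1
    · simpa [offBlock, h] using hτ0
    · simpa [offBlock, h] using
        (integral_blockNoise_sq_le hΨ hA i j).trans (hτ _ _ (Ne.symm h))
  · have h := hW.indep.comp (fun e x => if e.1.1.1 = e.1.2.1 then 0 else x) fun e => by
      split_ifs
      · exact measurable_const
      · exact measurable_id
    exact h

theorem measureReal_rowSum_ge_le (hΨ : IsEdgeProbMatrix Ψ) (hA : IsBalancedBlockModel μ m Ψ A)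
    (i : Fin K × Fin m) (c : Fin K) {M l : ℝ} (hl : 0 < l) (hlM : l ≤ M)
    (hM : m * Ψ i.1 c ≤ M) :
    μ.real {ω | 5 * √(M * l) ≤ |∑ b, blockNoise Ψ (A ω) i (c, b)|} ≤
      2 * Real.exp (-(4 * l)) := by
  have hW := blockNoise_isCenteredNoise hΨ hA
  -- Row `i` is independent because distinct `j` give distinct unordered pairs; `g` picks the
  -- increasing representative.
  let g : {j : Fin K × Fin m // j ≠ i} →
      {e : (Fin K × Fin m) × (Fin K × Fin m) // toLex e.1 < toLex e.2} := fun j =>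
    if h : toLex i < toLex j.1 then ⟨(i, j.1), h⟩ else
      ⟨(j.1, i), lt_of_le_of_ne (not_lt.1 h) fun h' => j.2 (toLex.injective h')⟩
  have hg : Function.Injective g := by
    rintro ⟨j, hj⟩ ⟨j', hj'⟩ heq
    simp only [g] at heq
    split_ifs at heq <;> simp only [Subtype.mk.injEq, Prod.mk.injEq] at heq
    · simp [heq]
    · exact absurd heq.2 hj
    · exact absurd heq.1 hj
    · simp [heq]
  have hind : iIndepFun (fun (j : {j : Fin K × Fin m // j ≠ i}) (ω : Ω) =>
      blockNoise Ψ (A ω) i j.1) μ := by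
    convert! hW.indep.precomp hg using 2 with j
    funext ω
    simp only [g]
    split_ifs
    · rfl
    · exact ((hW.symm ω).apply _ _)
  set s : Finset {j : Fin K × Fin m // j ≠ i} := Finset.univ.filter fun j => j.1.1 = c with hs
  have hsum : ∀ ω, ∑ b, blockNoise Ψ (A ω) i (c, b) = ∑ j ∈ s, blockNoise Ψ (A ω) i j.1 := by
    intro ω
    have h1 : ∑ b, blockNoise Ψ (A ω) i (c, b) =
        ∑ j ∈ Finset.univ.filter (fun j : Fin K × Fin m => j ≠ i),
          if j.1 = c then blockNoise Ψ (A ω) i j else 0 := by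
      rw [Finset.sum_filter_of_ne, Fintype.sum_prod_type_right]
      · exact Finset.sum_congr rfl fun b _ => by simp
      · rintro j - hj rfl
        exact hj (by rw [hW.diag]; simp)
    rw [h1, hs]
    refine Eq.trans ?_ (Finset.sum_filter _ _).symm
    exact Finset.sum_subtype (p := fun j => j ≠ i) (Finset.univ.filter fun j => j ≠ i) (by simp)
      fun j => if j.1 = c then blockNoise Ψ (A ω) i j else 0
  have hcard : (s.card : ℝ) ≤ m := by
    have : s.card ≤ (Finset.univ : Finset (Fin m)).card := by
      refine Finset.card_le_card_of_injOn (fun j => j.1.2) (fun _ _ => Finset.mem_univ _) ?_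
      intro j hj j' hj' h
      simp only [hs, Finset.coe_filter, Finset.mem_univ, true_and, Set.mem_ofPred_eq] at hj hj'
      exact Subtype.ext (Prod.ext (hj.trans hj'.symm) h)
    rw [Finset.card_univ, Fintype.card_fin] at this
    exact_mod_cast this
  simp_rw [hsum]
  refine measureReal_abs_sum_ge_le hind (fun j => hW.measurable _ _)
    (fun j ω => hW.abs_le_one ω _ _) (fun j => hW.integral_eq_zero _ _) s (v := Ψ i.1 c)
    (fun j hj => ?_) hl hlM ((mul_le_mul_of_nonneg_right hcard (hΨ.mem_Icc _ _).1).trans hM)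
  have hjc : j.1.1 = c := by simpa [hs] using hj
  rw [← hjc]
  exact integral_blockNoise_sq_le hΨ hA i j.1

end BlockNoise

/-! ### Cross-community probabilities -/

section QStar

variable {K : ℕ} {Ψ : Matrix (Fin K) (Fin K) ℝ}

theorem le_qStar (k l : Fin K) (h : l ≠ k) : Ψ k l ≤ qStar Ψ k :=
  le_ciSup (f := fun l : {l : Fin K // l ≠ k} => Ψ k l) (Set.finite_range _).bddAbove ⟨l, h⟩

theorem qStar_le_qStarMax (k : Fin K) : qStar Ψ k ≤ qStarMax Ψ :=
  le_ciSup (Set.finite_range _).bddAbove k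

theorem qStar_nonneg (hΨ : IsEdgeProbMatrix Ψ) (k : Fin K) : 0 ≤ qStar Ψ k :=
  Real.iSup_nonneg fun _ => (hΨ.mem_Icc _ _).1

theorem qStarMax_nonneg (hΨ : IsEdgeProbMatrix Ψ) : 0 ≤ qStarMax Ψ :=
  Real.iSup_nonneg fun k => qStar_nonneg hΨ k

theorem qStarMax_le_one (hΨ : IsEdgeProbMatrix Ψ) : qStarMax Ψ ≤ 1 :=
  Real.iSup_le (fun _ => Real.iSup_le (fun _ => (hΨ.mem_Icc _ _).2) zero_le_one) zero_le_one

end QStar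

/-! ### Exact recovery -/

/-- Exact recovery with an explicit probability bound, with all quantities on the scale of
expected degrees. -/
theorem measureReal_sdp1_eq_ge {Ω : Type*} [MeasurableSpace Ω] {μ : Measure Ω}
    [IsProbabilityMeasure μ] {K m n : ℕ} (hK : 0 < K) (hm : 0 < m) (hn : n = m * K) (hn2 : 2 ≤ n)
    {Ψ : Matrix (Fin K) (Fin K) ℝ} (hΨ : IsEdgeProbMatrix Ψ) (hwa : WeaklyAssortative Ψ)
    {A : Ω → Matrix (Fin K × Fin m) (Fin K × Fin m) ℝ} (hA : IsBalancedBlockModel μ m Ψ A)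
    (hp : ∀ k, Real.log n ≤ m * Ψ k k)
    (hgap : ∀ k, (30 + 4 * noiseConst) * (√(m * Ψ k k * Real.log n) + √(n * qStarMax Ψ)) <
      m * (Ψ k k - qStar Ψ k)) :
    1 - (K * (m : ℝ)⁻¹ + 3 * (n : ℝ)⁻¹) ≤
      μ.real {ω | sdp1 K (A ω) = {clusterMatrix K m}} := by
  have hN : 0 ≤ noiseConst := Real.sqrt_nonneg _
  have hn2' : (2 : ℝ) ≤ n := by exact_mod_cast hn2
  have hn0 : (0 : ℝ) < n := by linarith
  have hm1 : (1 : ℝ) ≤ m := by exact_mod_cast hm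
  have hK1 : (1 : ℝ) ≤ K := by exact_mod_cast hK
  have hnmK : (n : ℝ) = m * K := by rw [hn]; push_cast; rfl
  set l := Real.log n with hl
  have hl4 : 1 / 4 ≤ l := by
    have h1 : Real.log 2 ≤ l := Real.log_le_log (by norm_num) hn2'
    linarith [Real.log_two_gt_d9]
  have hl0 : 0 < l := by linarith
  have hln : l ≤ n := (Real.log_le_sub_one_of_pos hn0).trans (by linarith)
  have hqm0 := qStarMax_nonneg hΨ
  -- The floor `log n / n` secures the degree condition even if the cross-community probabilities
  -- are tiny; its cost `√(log n)` is absorbed by `√(m p_k)`.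
  set τ : ℝ := max (qStarMax Ψ) (l / n) with hτ
  have hτ0 : 0 ≤ τ := hqm0.trans (le_max_left _ _)
  have hτ1 : τ ≤ 1 := max_le (qStarMax_le_one hΨ) ((div_le_one hn0).2 hln)
  have hΨτ : ∀ k j, j ≠ k → Ψ k j ≤ τ := fun k j h =>
    ((le_qStar k j h).trans (qStar_le_qStarMax k)).trans (le_max_left _ _)
  have hnτ : n * τ = max (n * qStarMax Ψ) l := by
    rw [hτ, mul_max_of_nonneg _ _ hn0.le, mul_div_cancel₀ _ hn0.ne']
  have hcardV : Fintype.card (Fin K × Fin m) = n := by simp [hn, mul_comm]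
  -- By assortativity `m p_k` bounds the variance of every block row sum from community `k`.
  have hΨle : ∀ k j, Ψ k j ≤ Ψ k k := fun k j => by
    rcases eq_or_ne j k with rfl | h
    · exact le_rfl
    · exact (le_qStar k j h).trans (hwa k).le
  set badBlock : Fin K → Set Ω := fun k => {ω | noiseConst * √(m * Ψ k k) <
    ‖Matrix.toEuclideanCLM (𝕜 := ℝ) (diagBlock (blockNoise Ψ (A ω)) k)‖} with hbadBlock
  set badOff : Set Ω := {ω | noiseConst * √(n * τ) <
    ‖Matrix.toEuclideanCLM (𝕜 := ℝ) (offBlock (blockNoise Ψ (A ω)))‖} with hbadOff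
  set badRow : (Fin K × Fin m) × Fin K → Set Ω := fun x => {ω | 5 * √(m * Ψ x.1.1 x.1.1 * l) ≤
    |∑ b, blockNoise Ψ (A ω) x.1 (x.2, b)|} with hbadRow
  have hpBlock : ∀ k, μ.real (badBlock k) ≤ (m : ℝ)⁻¹ := fun k =>
    (diagBlock_isCenteredNoise hΨ hA k).measureReal_lt_norm_le Function.injective_id
      (hΨ.mem_Icc _ _).1 (hΨ.mem_Icc _ _).2 hm (Fintype.card_fin m)
      (le_trans (Real.log_le_log (by linarith) (by rw [hnmK]; nlinarith)) (hp k))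
  have hpOff : μ.real badOff ≤ (n : ℝ)⁻¹ :=
    (offBlock_isCenteredNoise hΨ hA hτ0 hΨτ).measureReal_lt_norm_le toLex.injective hτ0 hτ1
      (by omega) hcardV (by rw [hnτ]; exact le_max_right _ _)
  have hpRow : ∀ x, μ.real (badRow x) ≤ 2 * ((n : ℝ) ^ 4)⁻¹ := fun x => by
    have h := measureReal_rowSum_ge_le hΨ hA x.1 x.2 hl0 (hp x.1.1)
      (mul_le_mul_of_nonneg_left (hΨle x.1.1 x.2) (by linarith))
    have h4 : Real.exp (-(4 * l)) = ((n : ℝ) ^ 4)⁻¹ := by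
      rw [Real.exp_neg, mul_comm, Real.exp_mul, hl, Real.exp_log hn0]
      norm_cast
    rw [h4] at h
    exact h
  have hcover : (Set.univ : Set Ω) ⊆ {ω | sdp1 K (A ω) = {clusterMatrix K m}} ∪
      ((⋃ k, badBlock k) ∪ (badOff ∪ ⋃ x, badRow x)) := by
    intro ω _
    by_cases hω : ω ∈ (⋃ k, badBlock k) ∪ (badOff ∪ ⋃ x, badRow x)
    · exact Or.inr hω
    left
    simp only [Set.mem_union, Set.mem_iUnion, not_or, not_exists] at hω
    obtain ⟨h1, h2, h3⟩ := hω
    refine sdp1_eq_singleton hK hm (W := blockNoise Ψ (A ω)) (Ψ := Ψ)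
      ((blockNoise_isCenteredNoise hΨ hA).symm ω) (fun i j hij => by simp [blockNoise, hij])
      (qStar Ψ) (fun k => 5 * √(m * Ψ k k * l)) (fun k => noiseConst * √(m * Ψ k k))
      (noiseConst * √(n * τ)) (fun k j h => le_qStar k j h)
      (fun i c => (not_le.1 (h3 (i, c))).le) (fun k => not_lt.1 (h1 k)) (not_lt.1 h2) fun k => ?_
    have ha : 0 ≤ m * Ψ k k := hl0.le.trans (hp k)
    -- Origin of `30 + 4 * noiseConst`: row sums give `6 * 5`; the diagonal block and the floor in
    -- `τ` each give `noiseConst * √(m p_k)`, at most twice `noiseConst * √(m p_k log n)` since `log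
    -- n ≥ 1/4`.
    have e1 : √(m * Ψ k k) ≤ 2 * √(m * Ψ k k * l) := by
      rw [show (2 : ℝ) = √4 by rw [show (4 : ℝ) = 2 ^ 2 by norm_num, Real.sqrt_sq (by norm_num)],
        ← Real.sqrt_mul (by norm_num)]
      exact Real.sqrt_le_sqrt (by nlinarith)
    have e2 : √(n * τ) ≤ √(n * qStarMax Ψ) + √(m * Ψ k k) := by
      rw [hnτ]
      rcases max_choice (n * qStarMax Ψ) l with h | h <;> rw [h]
      · linarith [Real.sqrt_nonneg (m * Ψ k k)]
      · linarith [Real.sqrt_le_sqrt (hp k), Real.sqrt_nonneg (n * qStarMax Ψ)]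
    have e3 := mul_le_mul_of_nonneg_left e1 hN
    have e4 := mul_le_mul_of_nonneg_left e2 hN
    have e5 := mul_nonneg hN (Real.sqrt_nonneg (n * qStarMax Ψ))
    have e6 := Real.sqrt_nonneg (n * qStarMax Ψ)
    refine lt_of_le_of_lt ?_ (hgap k)
    nlinarith
  have hU1 : μ.real (⋃ k, badBlock k) ≤ K * (m : ℝ)⁻¹ := by
    refine (measureReal_iUnion_fintype_le _).trans
      ((Finset.sum_le_sum fun k _ => hpBlock k).trans ?_)
    simp
  have hU3 : μ.real (⋃ x, badRow x) ≤ 2 * (n : ℝ)⁻¹ := by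
    refine (measureReal_iUnion_fintype_le _).trans
      ((Finset.sum_le_sum fun x _ => hpRow x).trans ?_)
    rw [Finset.sum_const, Finset.card_univ, Fintype.card_prod, hcardV, Fintype.card_fin,
      nsmul_eq_mul]
    push_cast
    have hKn : (K : ℝ) ≤ n := by rw [hnmK]; nlinarith
    -- The exponent `4` in the row tail pays for the union over `nK ≤ n ^ 2` block row sums.
    calc (n * K : ℝ) * (2 * ((n : ℝ) ^ 4)⁻¹) ≤ (n * n) * (2 * ((n : ℝ) ^ 4)⁻¹) := by gcongr
      _ = 2 * (n : ℝ)⁻¹ * (n : ℝ)⁻¹ := by field_simp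
      _ ≤ 2 * (n : ℝ)⁻¹ * 1 := by
          gcongr
          exact inv_le_one_of_one_le₀ (by linarith)
      _ = _ := mul_one _
  have h1 := (measureReal_mono (μ := μ) hcover).trans (measureReal_union_le _ _)
  have h2 := measureReal_union_le (μ := μ) (⋃ k, badBlock k) (badOff ∪ ⋃ x, badRow x)
  have h3 := measureReal_union_le (μ := μ) badOff (⋃ x, badRow x)
  rw [probReal_univ] at h1
  linarith

end SDPBlockModel

end

/-! ### Choice of constants and return to the rescaled parameters. -/

theorem mainTheorem1 :
    ∃ C C' c r : ℝ, 0 < C ∧ 0 < C' ∧ 0 < c ∧ 0 < r ∧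
      SDPBlockModel.AdjacencyConcentration.{u} C C' c r ∧
      ∀ c₁ c₂ : ℝ, 0 < c₁ → 0 < c₂ →
      ∀ C₁ C₂ : ℝ, C₁ = max C' (4 / 9 * (c₁ + 1)) →
        C₂ = max (√(4 * (c₁ + 1)) + C) (6 * √(2 * (c₂ + 1))) →
      ∀ (K m n : ℕ), 0 < K → 0 < m → n = m * K →
      ∀ (Ψ : Matrix (Fin K) (Fin K) ℝ), SDPBlockModel.IsEdgeProbMatrix Ψ →
        SDPBlockModel.WeaklyAssortative Ψ →
      ∀ (Ω : Type u) [MeasurableSpace Ω] (μ : MeasureTheory.Measure Ω)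
        [MeasureTheory.IsProbabilityMeasure μ]
        (A : Ω → Matrix (Fin K × Fin m) (Fin K × Fin m) ℝ),
        SDPBlockModel.IsBalancedBlockModel μ m Ψ A →
        (∀ k, C₁ ≤ SDPBlockModel.tilde K m (Ψ k k)) →
        (∀ k, C * √(SDPBlockModel.tilde K m (SDPBlockModel.qStarMax Ψ) * K / Real.log n) <
          (SDPBlockModel.tilde K m (Ψ k k) - SDPBlockModel.tilde K m (SDPBlockModel.qStar Ψ k)) -
            C₂ * (√(SDPBlockModel.tilde K m (Ψ k k)) +
              √(SDPBlockModel.tilde K m (SDPBlockModel.qStar Ψ k)))) →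
        1 - c * (K * (m : ℝ) ^ (-r) + (n : ℝ) ^ (-r)) - (n : ℝ) ^ (-c₁)
            - 2 * (m : ℝ)⁻¹ * (n : ℝ) ^ (-c₂) ≤
          μ.real {ω | SDPBlockModel.sdp1 K (A ω) = {SDPBlockModel.clusterMatrix K m}} := by
  have hN : 0 ≤ SDPBlockModel.noiseConst := Real.sqrt_nonneg _
  refine ⟨30 + 4 * SDPBlockModel.noiseConst, 1, 4, 1, by linarith, one_pos, by norm_num, one_pos,
    SDPBlockModel.adjacencyConcentration, ?_⟩
  intro c₁ c₂ _ _ C₁ C₂ hC₁ hC₂ K m n hK hm hn Ψ hΨ hwa Ω _ μ _ A hA hp hgap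
  have hC₁1 : 1 ≤ C₁ := hC₁ ▸ le_max_left _ _
  have hC₂C : 30 + 4 * SDPBlockModel.noiseConst ≤ C₂ := by
    rw [hC₂]
    exact le_trans (by linarith [Real.sqrt_nonneg (4 * (c₁ + 1))]) (le_max_left _ _)
  have hm0 : (0 : ℝ) < m := by exact_mod_cast hm
  have hK0 : (0 : ℝ) < K := by exact_mod_cast hK
  have hn0 : (0 : ℝ) < n := by rw [hn]; push_cast; positivity
  simp only [SDPBlockModel.tilde, ← hn] at hp hgap
  -- If `log n = 0`, division by zero makes every rescaled `p_k` equal to `0`, against `C₁ ≥ 1`;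
  -- this excludes `n = 1`.
  have hl0 : 0 < Real.log n := by
    refine lt_of_le_of_ne (Real.log_natCast_nonneg n) fun h => ?_
    have := hp ⟨0, hK⟩
    rw [← h, div_zero] at this
    linarith
  have hn2 : 2 ≤ n := by
    by_contra h
    have h1 : (n : ℝ) ≤ 1 := by exact_mod_cast (by omega : n ≤ 1)
    exact absurd (Real.log_nonpos hn0.le h1) (not_le.2 hl0)
  set l := Real.log n with hl
  have hsqrt : ∀ x : ℝ, l * √(x / l) = √(x * l) := fun x => by
    have h1 : x * l = l ^ 2 * (x / l) := by field_simp
    rw [h1, Real.sqrt_mul (sq_nonneg _), Real.sqrt_sq hl0.le]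
  have hp' : ∀ k, l ≤ m * Ψ k k := fun k => by
    have h1 := (le_div_iff₀ hl0).1 (hC₁1.trans (hp k))
    linarith
  refine le_trans ?_ (SDPBlockModel.measureReal_sdp1_eq_ge hK hm hn hn2 hΨ hwa hA hp' fun k => ?_)
  · rw [Real.rpow_neg_one, Real.rpow_neg_one]
    have h1 : 0 ≤ (n : ℝ) ^ (-c₁) := by positivity
    have h2 : 0 ≤ 2 * (m : ℝ)⁻¹ * (n : ℝ) ^ (-c₂) := by positivity
    have h3 : 0 ≤ K * (m : ℝ)⁻¹ := by positivity
    have h4 : 0 ≤ (n : ℝ)⁻¹ := by positivity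
    linarith
  · set C := 30 + 4 * SDPBlockModel.noiseConst with hC
    -- Multiplication by `log n` returns to expected degrees: `√(p̃_k)` becomes `√(m p_k log n)`,
    -- and the right-hand radical of the assumption becomes `√(n q*_max)`.
    have h1 := mul_lt_mul_of_pos_left (hgap k) hl0
    have h2 : l * √(SDPBlockModel.qStarMax Ψ * m / l * K / l) =
        √(n * SDPBlockModel.qStarMax Ψ) := by
      have h3 : n * SDPBlockModel.qStarMax Ψ =
          l ^ 2 * (SDPBlockModel.qStarMax Ψ * m / l * K / l) := by
        rw [hn]
        push_cast
        field_simp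
      rw [h3, Real.sqrt_mul (sq_nonneg _), Real.sqrt_sq hl0.le]
    have h4 := hsqrt (Ψ k k * m)
    have h5 : l * (Ψ k k * m / l) = Ψ k k * m := by field_simp
    have h6 : l * (SDPBlockModel.qStar Ψ k * m / l) = SDPBlockModel.qStar Ψ k * m := by field_simp
    have h7 : 0 ≤ C₂ * (l * √(SDPBlockModel.qStar Ψ k * m / l)) :=
      mul_nonneg (by linarith) (mul_nonneg hl0.le (Real.sqrt_nonneg _))
    have h8 := mul_le_mul_of_nonneg_right hC₂C (Real.sqrt_nonneg (Ψ k k * m * l))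
    rw [mul_comm (m : ℝ) (Ψ k k)]
    calc C * (√(Ψ k k * m * l) + √(n * SDPBlockModel.qStarMax Ψ))
        ≤ C₂ * √(Ψ k k * m * l) + C * √(n * SDPBlockModel.qStarMax Ψ) := by linarith
      _ = C₂ * (l * √(Ψ k k * m / l)) +
            l * (C * √(SDPBlockModel.qStarMax Ψ * m / l * K / l)) := by
          rw [← h2, h4]
          ring
      _ < m * (Ψ k k - SDPBlockModel.qStar Ψ k) := by
          linear_combination h1 + h7 + h5 - h6
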